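/- Let $(X,\mu)$ be a standard probability space (a standard Borel space with a non-atomic Borel probability measure), and let $\mathrm{Aut}(X,\mu)$ be the group of measure-preserving Borel bijections of $X$, two of them being identified when they agree $\mu$-almost everywhere. Let $G$ be a Polish group with a Borel, $\mu$-preserving action $G\times X\to X$. The action is called suitable if for all Borel sets $A,B\subseteq X$ of positive measure one of the following holds: (1) for every open neighbourhood $O$ of the identity in $G$ there is $g\in O$ with $\mu(A\cap gB)>0$; (2) there are Borel sets $A'\subseteq A$ and $B'\subseteq B$ with $\mu(A\setminus A')=\mu(B\setminus B')=0$ and an open neighbourhood $O$ of the identity in $G$ with $(OA')\cap B'=\emptyset$. The orbit full group is $[\mathcal R_G]=\{T\in\mathrm{Aut}(X,\mu): T(x)\in G\cdot x \text{ for every } x\in X\}$ (that is, $T$ has a representative with this property). For a class $f\in \mathrm L^0(X,\mu,G)$ of measurable functions $X\to G$ up to almost everywhere equality let $\Phi(f)(x)=f(x)\cdot x$, and let $\widetilde{[\mathcal R_G]}$ be the set of all $f$ for which $\Phi(f)$ agrees almost everywhere with an element of $[\mathcal R_G]$. It is a group for the product $(f\cdot g)(x)=f(g(x)x)\,g(x)$,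 and $\Phi:\widetilde{[\mathcal R_G]}\to[\mathcal R_G]$ is a homomorphism. Fix any bounded metric $d$ on $G$ which induces its topology. The group $\widetilde{[\mathcal R_G]}$ carries the topology of convergence in measure, which is the topology of the metric $\tilde d(f,g)=\int_X d(f(x),g(x))\,d\mu(x)$, and $[\mathcal R_G]$ carries the quotient topology induced by $\Phi$. Let $\widetilde{[G]}_D\subseteq\widetilde{[\mathcal R_G]}$ be the set of elements $f$ with countable essential image (there is a countable $C\subseteq G$ with $f(x)\in C$ for almost every $x$). A subgroup $K\leq\mathrm{Aut}(X,\mu)$ is called full if $T\in K$ whenever $T\in\mathrm{Aut}(X,\mu)$ and there are pairwise disjoint measurable sets $A_n$ ($n\in\mathbb N$) whose union has full measure and elements $T_n\in K$ such that $T=T_n$ almost everywhere on $A_n$ for every $n$. Theorem. If the action is suitable, then $\widetilde{[G]}_D$ is a dense subgroup of $\widetilde{[\mathcal R_G]}$. Moreover $[G]_D:=\Phi(\widetilde{[G]}_D)$ is the smallest full subgroup of $\mathrm{Aut}(X,\mu)$ containing the image of $G$, and it is dense in $[\mathcal R_G]$. -/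

import Mathlib

open MeasureTheory
open scoped Pointwise

noncomputable section

namespace FullGroup

section Aut

variable {X : Type*} [MeasurableSpace X]

/-- The group of all measure-preserving Borel bijections of `(X, μ)`
(before identifying those that agree almost everywhere). -/
def MPBij (μ : Measure X) : Subgroup (Equiv.Perm X) where
  carrier := {T | MeasurePreserving T μ μ ∧ MeasurePreserving T.symm μ μ}
  mul_mem' := fun hS hT => ⟨hS.1.comp hT.1, hT.2.comp hS.2⟩
  one_mem' := ⟨MeasurePreserving.id μ, MeasurePreserving.id μ⟩
  inv_mem' := fun hS => ⟨hS.2, hS.1⟩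

theorem mp {μ : Measure X} (T : MPBij μ) :
    MeasurePreserving (T : Equiv.Perm X) μ μ := T.2.1

theorem mp_symm {μ : Measure X} (T : MPBij μ) :
    MeasurePreserving (T : Equiv.Perm X).symm μ μ := T.2.2

/-- The bijections that are the identity almost everywhere. -/
def aeId (μ : Measure X) : Subgroup (MPBij μ) where
  carrier := {T | ∀ᵐ x ∂μ, (T : Equiv.Perm X) x = x}
  mul_mem' := by
    intro S T hS hT
    have hS' : ∀ᵐ x ∂μ, (S : Equiv.Perm X) x = x := hS
    have hT' : ∀ᵐ x ∂μ, (T : Equiv.Perm X) x = x := hT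
    show ∀ᵐ x ∂μ, ((S * T : MPBij μ) : Equiv.Perm X) x = x
    filter_upwards [hT', (mp T).quasiMeasurePreserving.ae hS'] with x h1 h2
    show (S : Equiv.Perm X) ((T : Equiv.Perm X) x) = x
    rw [h2, h1]
  one_mem' := by
    show ∀ᵐ x ∂μ, ((1 : MPBij μ) : Equiv.Perm X) x = x
    exact Filter.Eventually.of_forall fun _ => rfl
  inv_mem' := by
    intro S hS
    have hS' : ∀ᵐ x ∂μ, (S : Equiv.Perm X) x = x := hS
    show ∀ᵐ x ∂μ, ((S⁻¹ : MPBij μ) : Equiv.Perm X) x = x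
    filter_upwards [hS'] with x h1
    show (S : Equiv.Perm X).symm x = x
    rw [Equiv.symm_apply_eq, h1]

instance aeId_normal (μ : Measure X) : (aeId μ).Normal where
  conj_mem := by
    intro S hS T
    have hS' : ∀ᵐ x ∂μ, (S : Equiv.Perm X) x = x := hS
    show ∀ᵐ x ∂μ, ((T * S * T⁻¹ : MPBij μ) : Equiv.Perm X) x = x
    filter_upwards [(mp_symm T).quasiMeasurePreserving.ae hS'] with x h1
    show (T : Equiv.Perm X) ((S : Equiv.Perm X) ((T : Equiv.Perm X).symm x)) = x
    rw [h1, Equiv.apply_symm_apply]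

/-- `Aut(X, μ)`: measure-preserving Borel bijections up to almost everywhere equality. -/
abbrev Aut (μ : Measure X) : Type _ := MPBij μ ⧸ aeId μ

/-- The class in `Aut(X, μ)` of a measure-preserving Borel bijection. -/
def toAut (μ : Measure X) : MPBij μ →* Aut μ := QuotientGroup.mk' (aeId μ)

theorem toAut_eq_iff {μ : Measure X} (S T : MPBij μ) :
    toAut μ S = toAut μ T ↔ ∀ᵐ x ∂μ, (S : Equiv.Perm X) x = (T : Equiv.Perm X) x := by
  have h : toAut μ S = toAut μ T ↔ S⁻¹ * T ∈ aeId μ := QuotientGroup.eq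
  rw [h]
  show (∀ᵐ x ∂μ, ((S⁻¹ * T : MPBij μ) : Equiv.Perm X) x = x) ↔ _
  refine Filter.eventually_congr (Filter.Eventually.of_forall fun x => ?_)
  show (S : Equiv.Perm X).symm ((T : Equiv.Perm X) x) = x ↔ _
  rw [Equiv.symm_apply_eq, eq_comm]

/-- Dye's notion of a full subgroup of `Aut(X, μ)`: it is stable under cutting and pasting along
countable measurable partitions of a full measure subset. -/
def IsFull {μ : Measure X} (K : Subgroup (Aut μ)) : Prop :=
  ∀ (A : ℕ → Set X) (S : ℕ → MPBij μ) (T : MPBij μ),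
    (∀ n, MeasurableSet (A n)) → Pairwise (fun m n => Disjoint (A m) (A n)) →
    μ (⋃ n, A n)ᶜ = 0 →
    (∀ n, toAut μ (S n) ∈ K) →
    (∀ n, ∀ᵐ x ∂μ, x ∈ A n → (T : Equiv.Perm X) x = (S n : Equiv.Perm X) x) →
    toAut μ T ∈ K

end Aut

section Action

variable (G : Type*) {X : Type*} [Group G] [MeasurableSpace X] [MulAction G X]

/-- Becker's suitable actions. -/
def IsSuitable [TopologicalSpace G] (μ : Measure X) : Prop :=
  ∀ A B : Set X, MeasurableSet A → MeasurableSet B → 0 < μ A → 0 < μ B →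
    (∀ O : Set G, IsOpen O → (1 : G) ∈ O → ∃ g ∈ O, 0 < μ (A ∩ g • B)) ∨
    (∃ A' B' : Set X, A' ⊆ A ∧ B' ⊆ B ∧ MeasurableSet A' ∧ MeasurableSet B' ∧
      μ (A \ A') = 0 ∧ μ (B \ B') = 0 ∧
      ∃ O : Set G, IsOpen O ∧ (1 : G) ∈ O ∧ (O • A') ∩ B' = ∅)

/-- The homomorphism `G → Aut(X, μ)` induced by a measure-preserving action. -/
def actionHom [MeasurableConstSMul G X] (μ : Measure X) [SMulInvariantMeasure G X μ] :
    G →* Aut μ :=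
  (toAut μ).comp ((MulAction.toPermHom G X).codRestrict (MPBij μ) fun g =>
    ⟨measurePreserving_smul g μ, measurePreserving_smul g⁻¹ μ⟩)

/-- The measure-preserving Borel bijections `T` with `T x ∈ G • x` for every `x`. -/
def orbitBij (μ : Measure X) : Subgroup (MPBij μ) where
  carrier := {T | ∀ x, (T : Equiv.Perm X) x ∈ MulAction.orbit G x}
  mul_mem' := by
    intro S T hS hT x
    have h := hS ((T : Equiv.Perm X) x)
    rw [MulAction.orbit_eq_iff.mpr (hT x)] at h
    exact h
  one_mem' := fun x => MulAction.mem_orbit_self x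
  inv_mem' := by
    intro S hS x
    have h := hS ((S : Equiv.Perm X).symm x)
    rw [Equiv.apply_symm_apply] at h
    exact MulAction.mem_orbit_symm.mp h

/-- The orbit full group `[R_G]`, a subgroup of `Aut(X, μ)`. -/
def orbitFullGroup (μ : Measure X) : Subgroup (Aut μ) := (orbitBij G μ).map (toAut μ)

variable [TopologicalSpace G]

/-- The lifted full group: classes in `L⁰(X, μ, G)` of functions `f` such that
`Φ(f) : x ↦ f x • x` is (almost everywhere equal to) an element of the orbit full group. -/
def Lifted (μ : Measure X) : Type _ :=
  {f : X →ₘ[μ] G // ∃ T ∈ orbitBij G μ, ∀ᵐ x ∂μ, f x • x = (T : Equiv.Perm X) x}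

namespace Lifted

variable {G} {μ : Measure X}

/-- A bijection preserving all orbits that is almost everywhere equal to `x ↦ f x • x`. -/
def bij (f : Lifted G μ) : MPBij μ := f.2.choose

theorem bij_mem (f : Lifted G μ) : f.bij ∈ orbitBij G μ := f.2.choose_spec.1

theorem bij_spec (f : Lifted G μ) : ∀ᵐ x ∂μ, f.1 x • x = (f.bij : Equiv.Perm X) x :=
  f.2.choose_spec.2

variable [IsTopologicalGroup G]

/-- The product `(f · g)(x) = f (g x • x) * g x`. -/
instance : Mul (Lifted G μ) where
  mul f g := ⟨f.1.compMeasurePreserving (g.bij : Equiv.Perm X) (mp g.bij) * g.1,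
    f.bij * g.bij, mul_mem f.bij_mem g.bij_mem, by
      filter_upwards [AEEqFun.coeFn_mul
          (f.1.compMeasurePreserving (g.bij : Equiv.Perm X) (mp g.bij)) g.1,
        f.1.coeFn_compMeasurePreserving (mp g.bij), g.bij_spec,
        (mp g.bij).quasiMeasurePreserving.ae f.bij_spec] with x h1 h2 h3 h4
      rw [h1, Pi.mul_apply, h2, mul_smul, h3]
      exact h4⟩

instance : One (Lifted G μ) where
  one := ⟨1, 1, one_mem _, by
    filter_upwards [AEEqFun.coeFn_one (α := X) (β := G) (μ := μ)] with x h
    rw [h, Pi.one_apply, one_smul]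
    rfl⟩

instance : Inv (Lifted G μ) where
  inv f := ⟨(f.1.compMeasurePreserving (f.bij : Equiv.Perm X).symm (mp_symm f.bij))⁻¹,
    f.bij⁻¹, inv_mem f.bij_mem, by
      filter_upwards [AEEqFun.coeFn_inv
          (f.1.compMeasurePreserving (f.bij : Equiv.Perm X).symm (mp_symm f.bij)),
        f.1.coeFn_compMeasurePreserving (mp_symm f.bij),
        (mp_symm f.bij).quasiMeasurePreserving.ae f.bij_spec] with x h1 h2 h3
      rw [h1, Pi.inv_apply, h2, inv_smul_eq_iff]
      rw [Equiv.apply_symm_apply] at h3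
      exact h3.symm⟩

theorem mul_ae (f g : Lifted G μ) : ∀ᵐ x ∂μ, (f * g).1 x = f.1 (g.1 x • x) * g.1 x := by
  filter_upwards [AEEqFun.coeFn_mul
      (f.1.compMeasurePreserving (g.bij : Equiv.Perm X) (mp g.bij)) g.1,
    f.1.coeFn_compMeasurePreserving (mp g.bij), g.bij_spec] with x h1 h2 h3
  rw [h3]
  refine Eq.trans h1 ?_
  rw [Pi.mul_apply, h2]
  rfl

theorem one_ae : ∀ᵐ x ∂μ, (1 : Lifted G μ).1 x = 1 := AEEqFun.coeFn_one

theorem inv_ae (f : Lifted G μ) :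
    ∀ᵐ x ∂μ, (f⁻¹).1 x = (f.1 ((f.bij : Equiv.Perm X).symm x))⁻¹ := by
  filter_upwards [AEEqFun.coeFn_inv
      (f.1.compMeasurePreserving (f.bij : Equiv.Perm X).symm (mp_symm f.bij)),
    f.1.coeFn_compMeasurePreserving (mp_symm f.bij)] with x h1 h2
  refine Eq.trans h1 ?_
  rw [Pi.inv_apply, h2]
  rfl

theorem ext_ae {f g : Lifted G μ} (h : ∀ᵐ x ∂μ, f.1 x = g.1 x) : f = g :=
  Subtype.ext (AEEqFun.ext h)

/-- A property that holds almost everywhere holds at `f x • x` for almost every `x`. -/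
theorem ae_smul (f : Lifted G μ) {p : X → Prop} (h : ∀ᵐ x ∂μ, p x) :
    ∀ᵐ x ∂μ, p (f.1 x • x) := by
  filter_upwards [f.bij_spec, (mp f.bij).quasiMeasurePreserving.ae h] with x h1 h2
  rw [h1]
  exact h2

instance : Group (Lifted G μ) :=
  Group.ofLeftAxioms
    (by
      intro f g h
      refine ext_ae ?_
      filter_upwards [mul_ae (f * g) h, mul_ae f (g * h), mul_ae g h,
        h.ae_smul (mul_ae f g)] with x h1 h2 h3 h4
      rw [h1, h2, h3, h4, mul_smul, mul_assoc])
    (by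
      intro f
      refine ext_ae ?_
      filter_upwards [mul_ae 1 f, f.ae_smul (one_ae (G := G))] with x h1 h2
      rw [h1, h2, one_mul])
    (by
      intro f
      refine ext_ae ?_
      filter_upwards [mul_ae f⁻¹ f, f.ae_smul (inv_ae f), f.bij_spec,
        one_ae (G := G)] with x h1 h2 h3 h4
      rw [h1, h2, h3, Equiv.symm_apply_apply, h4, inv_mul_cancel])

variable (G μ) in
/-- The homomorphism `Φ` from the lifted full group to `Aut(X, μ)`:
`Φ(f)` is the class of `x ↦ f x • x`. -/
def Phi : Lifted G μ →* Aut μ :=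
  MonoidHom.mk' (fun f => toAut μ f.bij) (by
    intro f g
    rw [← map_mul, toAut_eq_iff]
    filter_upwards [(f * g).bij_spec, mul_ae f g, g.ae_smul f.bij_spec, g.bij_spec]
      with x h1 h2 h3 h4
    show _ = (f.bij : Equiv.Perm X) ((g.bij : Equiv.Perm X) x)
    rw [← h1, h2, mul_smul, h3, h4])

theorem Phi_eq_iff (f : Lifted G μ) (T : MPBij μ) :
    Phi G μ f = toAut μ T ↔ ∀ᵐ x ∂μ, f.1 x • x = (T : Equiv.Perm X) x := by
  refine (toAut_eq_iff f.bij T).trans ?_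
  refine Filter.eventually_congr ?_
  filter_upwards [f.bij_spec] with x h
  rw [h]

variable (G μ) in
/-- `Φ` as a homomorphism to the orbit full group. -/
def PhiOrbit : Lifted G μ →* orbitFullGroup G μ :=
  (Phi G μ).codRestrict (orbitFullGroup G μ) fun f => ⟨f.bij, f.bij_mem, rfl⟩

variable (G μ) in
/-- The elements of the lifted full group with countable essential image. -/
def countableRange : Subgroup (Lifted G μ) where
  carrier := {f | ∃ C : Set G, C.Countable ∧ ∀ᵐ x ∂μ, f.1 x ∈ C}
  mul_mem' := by
    rintro f g ⟨C, hC, hfC⟩ ⟨D, hD, hgD⟩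
    refine ⟨C * D, Set.Countable.image2 hC hD _, ?_⟩
    filter_upwards [mul_ae f g, g.ae_smul hfC, hgD] with x h1 h2 h3
    rw [h1]
    exact Set.mul_mem_mul h2 h3
  one_mem' := by
    refine ⟨{1}, Set.countable_singleton 1, ?_⟩
    filter_upwards [one_ae (G := G) (μ := μ)] with x h
    rw [h]
    rfl
  inv_mem' := by
    rintro f ⟨C, hC, hfC⟩
    refine ⟨C⁻¹, by rw [← Set.image_inv_eq_inv]; exact hC.image _, ?_⟩
    filter_upwards [inv_ae f, (mp_symm f.bij).quasiMeasurePreserving.ae hfC] with x h1 h2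
    rw [h1]
    exact Set.inv_mem_inv.mpr h2

end Lifted

/-- A bounded metric on `G` that induces the given topology of `G`. -/
structure CompatibleMetric where
  /-- the metric -/
  metric : MetricSpace G
  compatible : metric.toUniformSpace.toTopologicalSpace = ‹TopologicalSpace G›
  bounded : ∃ C : ℝ, ∀ a b : G, metric.dist a b ≤ C

namespace CompatibleMetric

variable {G} (d : CompatibleMetric G) (μ : Measure X)

/-- The metric `∫ d(f(x), g(x)) dμ(x)` on `L⁰(X, μ, G)`. -/
def distL0 (f g : X →ₘ[μ] G) : ℝ := ∫ x, d.metric.dist (f x) (g x) ∂μ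

/-- The topology of convergence in measure on the lifted full group: the metric topology of
`distL0`. -/
@[reducible] def liftedTopology : TopologicalSpace (Lifted G μ) where
  IsOpen U := ∀ f ∈ U, ∃ ε > 0, ∀ g : Lifted G μ, d.distL0 μ f.1 g.1 < ε → g ∈ U
  isOpen_univ := fun _ _ => ⟨1, one_pos, fun _ _ => trivial⟩
  isOpen_inter := by
    rintro U V hU hV f ⟨hfU, hfV⟩
    obtain ⟨a, ha, hU⟩ := hU f hfU
    obtain ⟨b, hb, hV⟩ := hV f hfV
    exact ⟨min a b, lt_min ha hb, fun g hg =>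
      ⟨hU g (hg.trans_le (min_le_left _ _)), hV g (hg.trans_le (min_le_right _ _))⟩⟩
  isOpen_sUnion := by
    rintro s hs f ⟨U, hU, hf⟩
    obtain ⟨a, ha, h⟩ := hs U hU f hf
    exact ⟨a, ha, fun g hg => ⟨U, hU, h g hg⟩⟩

/-- The topology of convergence in measure on the orbit full group: the quotient topology
induced by `Φ`. -/
@[reducible] def orbitTopology [IsTopologicalGroup G] : TopologicalSpace (orbitFullGroup G μ) :=
  (d.liftedTopology μ).coinduced (Lifted.PhiOrbit G μ)

end CompatibleMetric

end Action

end FullGroup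

end

/-! The heart is the density of the countable-valued elements. Given `f` and a neighbourhood `U` of
the identity, take group elements `g n` such that every group element is close to some `g n`. A move
by `γ` is allowed at `x` when `γ` and `f x` are close to the same `g n`. Match `X` to `X` greedily
by countably many such moves, tolerating a larger distance from `γ` to `g n` in each round. If the
matching exhausts `X`, it defines a countable-valued element, close to `f` wherever an early round
has acted.

Exhaustion is a Hopcroft-Karp argument (`GreedyMatching.mul_measure_A_le`). Start from the set `A m`
unmatched after `m` rounds and alternate: apply `T = Φ(f)`, then go back along the matching. After
`j < m` alternations the points reached under `T` differ from starting points by group elements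
allowed in round `j`, so maximality of that round forces them to be matched already. Pulling them
back gives a set disjoint from `A m`, so each alternation adds another `μ (A m)`. Hence `(m + 1) * μ
(A m) ≤ 1`.

Suitability enters once, in `IsSuitable.exists_null_forall_smul_notMem`. Maximality excludes each
single group element up to its own null set, while the alternating paths use uncountably many
elements; suitability supplies one null set for all of them.

Fullness and minimality of the image come from cutting into countably many pieces on which a
transformation acts as a fixed group element. Density downstairs follows since `Φ` maps onto the
orbit full group, by measurable uniformization. -/

namespace FullGroup

/-! ### Measurable uniformization almost everywhere -/

section Selection

open Set Filter Topology

/-- A continuous surjection from Baire space to a space with a finite outer regular measure maps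
some compact set onto a set of almost full measure. -/
theorem exists_isCompact_measure_image_compl_le {X : Type*} [TopologicalSpace X] [T2Space X]
    [MeasurableSpace X] [BorelSpace X] (μ : Measure X) [IsFiniteMeasure μ] [μ.OuterRegular]
    {p : (ℕ → ℕ) → X} (hp : Continuous p) (hsurj : Function.Surjective p)
    {ε : ENNReal} (hε : ε ≠ 0) :
    ∃ K : Set (ℕ → ℕ), IsCompact K ∧ μ (p '' K)ᶜ ≤ ε := by
  classical
  rcases eq_or_ne (μ univ) 0 with h0 | h0
  · exact ⟨∅, isCompact_empty, by simp [h0]⟩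
  -- Capacitability: bound the coordinates one at a time by `u k`, keeping the image of measure
  -- above `c`. The images `p '' S k` need not be Borel, but outer measure is still continuous along
  -- increasing unions.
  set c := μ univ - ε with hc
  have hcu : c < μ univ := ENNReal.sub_lt_self (measure_ne_top _ _) h0 hε
  let m : ℕ → Set (ℕ → ℕ) → ℕ := fun k S =>
    if h : ∃ m, c < μ (p '' (S ∩ {a | a k ≤ m})) then h.choose else 0
  let S : ℕ → Set (ℕ → ℕ) := fun k =>
    Nat.rec (motive := fun _ => Set (ℕ → ℕ)) univ (fun k S => S ∩ {a | a k ≤ m k S}) k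
  let u : ℕ → ℕ := fun k => m k (S k)
  have hSs : ∀ k, S (k + 1) = S k ∩ {a | a k ≤ u k} := fun k => rfl
  have hS : ∀ k, S k = {a | ∀ i < k, a i ≤ u i} := by
    intro k
    induction k with
    | zero => ext a; simp [S]
    | succ k ih =>
      rw [hSs, ih]
      ext a
      simp only [mem_inter_iff, mem_ofPred_eq, Nat.lt_succ_iff_lt_or_eq]
      constructor
      · rintro ⟨h1, h2⟩ i (hi | rfl)
        exacts [h1 i hi, h2]
      · exact fun h => ⟨fun i hi => h i (Or.inl hi), h k (Or.inr rfl)⟩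
  have hμ : ∀ k, c < μ (p '' S k) := by
    intro k
    induction k with
    | zero => simpa [S, hsurj.range_eq] using hcu
    | succ k ih =>
      have hex : ∃ m, c < μ (p '' (S k ∩ {a | a k ≤ m})) := by
        have hun : p '' S k = ⋃ m : ℕ, p '' (S k ∩ {a | a k ≤ m}) := by
          rw [← image_iUnion, ← inter_iUnion]
          congr 1
          ext a
          simp only [mem_inter_iff, mem_iUnion, mem_ofPred_eq]
          exact ⟨fun h => ⟨h, a k, le_rfl⟩, fun h => h.1⟩
        have hmono : Monotone fun m : ℕ => p '' (S k ∩ {a | a k ≤ m}) :=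
          fun m n hmn => image_mono (inter_subset_inter_right _ fun a ha => le_trans ha hmn)
        rw [hun, hmono.measure_iUnion] at ih
        exact lt_iSup_iff.mp ih
      have hm : m k (S k) = hex.choose := dif_pos hex
      rw [hSs]
      show c < μ (p '' (S k ∩ {a | a k ≤ m k (S k)}))
      rw [hm]
      exact hex.choose_spec
  set K : Set (ℕ → ℕ) := Set.pi univ fun i => Iic (u i) with hK
  have hKc : IsCompact K := isCompact_univ_pi fun i => (finite_Iic (u i)).isCompact
  refine ⟨K, hKc, ?_⟩
  -- Truncating bad points `a k ∈ S k` by `u` puts them in the compact `K`. Truncation leaves the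
  -- first `k` coordinates alone, so along a subsequence the `a k` themselves converge to a point of
  -- `K`.
  have hKU : ∀ U : Set X, IsOpen U → p '' K ⊆ U → ∃ k, S k ⊆ p ⁻¹' U := by
    intro U hU hKU
    by_contra! hcon
    have hcon' : ∀ k, ∃ a ∈ S k, p a ∉ U := fun k => by
      obtain ⟨a, ha, h⟩ := not_subset.mp (hcon k)
      exact ⟨a, ha, h⟩
    choose a haS haU using hcon'
    obtain ⟨b, hbK, φ, hφ, hlim⟩ := hKc.tendsto_subseq (x := fun k => a k ⊓ u)
      (fun k i _ => min_le_right (a k i) (u i))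
    have hlim' : Tendsto (fun k => a (φ k)) atTop (𝓝 b) := by
      rw [tendsto_pi_nhds] at hlim ⊢
      intro i
      refine (hlim i).congr' ?_
      filter_upwards [eventually_gt_atTop i] with k hk
      have h := haS (φ k)
      rw [hS] at h
      exact inf_eq_left.mpr (h i (lt_of_lt_of_le hk (hφ.id_le k)))
    have : Tendsto (fun k => p (a (φ k))) atTop (𝓝 (p b)) := (hp.tendsto b).comp hlim'
    obtain ⟨k, hk⟩ := (this.eventually (hU.mem_nhds (hKU ⟨b, hbK, rfl⟩))).exists
    exact haU _ hk
  have hcK : c ≤ μ (p '' K) := by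
    by_contra! hlt
    obtain ⟨U, hKU', hU, hUc⟩ := (p '' K).exists_isOpen_lt_of_lt c hlt
    obtain ⟨k, hk⟩ := hKU U hU hKU'
    exact absurd ((hμ k).trans_le (measure_mono (image_subset_iff.mpr hk))) hUc.not_gt
  rw [measure_compl (hKc.image hp).measurableSet (measure_ne_top _ _)]
  calc μ univ - μ (p '' K) ≤ μ univ - c := tsub_le_tsub_left hcK _
    _ ≤ ε := by rw [hc]; exact tsub_tsub_le

/-- A continuous map has a Borel right inverse on the image of a compact set. -/
theorem exists_measurable_rightInverse_of_isCompact {Z X : Type*} [TopologicalSpace Z]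
    [TopologicalSpace.MetrizableSpace Z] [MeasurableSpace Z] [BorelSpace Z]
    [Nonempty Z] [TopologicalSpace X] [T2Space X]
    [MeasurableSpace X] [BorelSpace X] {p : Z → X} (hp : Continuous p) {K : Set Z}
    (hK : IsCompact K) :
    ∃ σ : X → Z, Measurable σ ∧ ∀ x ∈ p '' K, p (σ x) = x := by
  classical
  rcases K.eq_empty_or_nonempty with rfl | hne
  · exact ⟨fun _ => Classical.arbitrary Z, measurable_const, by simp⟩
  have : Nonempty K := hne.to_subtype
  have : CompactSpace K := isCompact_iff_compactSpace.mp hK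
  let _ : MetricSpace K := TopologicalSpace.metrizableSpaceMetric K
  obtain ⟨q, hqc, hqs⟩ := exists_nat_bool_continuous_surjective_of_compact K
  let h : cantorSet → Z := fun t => q (cantorSetHomeomorphNatToBool t)
  have hh : Continuous h :=
    continuous_subtype_val.comp (hqc.comp cantorSetHomeomorphNatToBool.continuous)
  have hrange : ∀ x ∈ p '' K, ∃ t : cantorSet, p (h t) = x := by
    rintro _ ⟨z, hz, rfl⟩
    obtain ⟨b, hb⟩ := hqs ⟨z, hz⟩
    refine ⟨cantorSetHomeomorphNatToBool.symm b, ?_⟩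
    simp [h, hb]
  have : CompactSpace cantorSet := isCompact_iff_compactSpace.mp isCompact_cantorSet
  -- `K` is parametrized by the Cantor set, whose order selects the least point of each compact
  -- fibre. Sublevel sets of this choice are images of compact sets, hence Borel.
  let F : X → Set ℝ := fun x => Subtype.val '' {t : cantorSet | p (h t) = x}
  have hF : ∀ x, IsCompact (F x) := fun x =>
    ((isClosed_singleton (x := x)).preimage (hp.comp hh)).isCompact.image continuous_subtype_val
  let s : X → ℝ := fun x => if x ∈ p '' K then sInf (F x) else 0
  have hsF : ∀ x ∈ p '' K, sInf (F x) ∈ F x := fun x hx =>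
    (hF x).sInf_mem (by obtain ⟨t, ht⟩ := hrange x hx; exact ⟨t, t, ht, rfl⟩)
  have hpK : MeasurableSet (p '' K) := (hK.image hp).measurableSet
  have hs : Measurable s := by
    refine measurable_of_Iic fun c => ?_
    have hset : s ⁻¹' Iic c = (fun t => p (h t)) '' {t : cantorSet | (t : ℝ) ≤ c} ∪
        if 0 ≤ c then (p '' K)ᶜ else ∅ := by
      ext x
      by_cases hx : x ∈ p '' K
      · have h1 : x ∉ (if 0 ≤ c then (p '' K)ᶜ else ∅ : Set X) := by split_ifs <;> simp [hx]
        have h2 : s x = sInf (F x) := if_pos hx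
        simp only [mem_preimage, mem_Iic, mem_union, h1, or_false, h2, mem_image, mem_ofPred_eq]
        constructor
        · intro hle
          obtain ⟨t, ht, hts⟩ := hsF x hx
          exact ⟨t, hts.trans_le hle, ht⟩
        · rintro ⟨t, htc, ht⟩
          exact (csInf_le (hF x).bddBelow ⟨t, ht, rfl⟩).trans htc
      · have h1 : x ∉ (fun t => p (h t)) '' {t : cantorSet | (t : ℝ) ≤ c} := by
          rintro ⟨t, -, rfl⟩
          exact hx ⟨_, (q _).2, rfl⟩
        have h2 : s x = 0 := if_neg hx
        simp only [mem_preimage, mem_Iic, mem_union, h1, false_or, h2]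
        split_ifs with hc <;> simp [hc, hx]
    rw [hset]
    refine MeasurableSet.union ?_ (by split_ifs; exacts [hpK.compl, MeasurableSet.empty])
    refine IsCompact.measurableSet ?_
    exact ((isClosed_Iic.preimage continuous_subtype_val).isCompact).image (hp.comp hh)
  refine ⟨fun x => if hx : s x ∈ cantorSet then h ⟨s x, hx⟩ else Classical.arbitrary Z, ?_, ?_⟩
  · have : Measurable fun t : ℝ => if ht : t ∈ cantorSet then h ⟨t, ht⟩ else Classical.arbitrary Z :=
      Measurable.dite (s := cantorSet) hh.measurable measurable_const
        isClosed_cantorSet.measurableSet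
    exact this.comp hs
  · intro x hx
    obtain ⟨t, ht, hts⟩ := hsF x hx
    have hst : s x = t := (if_pos hx).trans hts.symm
    have hmem : s x ∈ cantorSet := hst ▸ t.2
    have hst' : (⟨s x, hmem⟩ : cantorSet) = t := Subtype.ext hst
    simp only [dif_pos hmem, hst']
    exact ht

/-- A Borel set with nonempty sections has an almost everywhere defined Borel uniformization. -/
theorem exists_measurable_ae_mem_of_sections_nonempty {X Y : Type*}
    [MeasurableSpace X] [StandardBorelSpace X] [MeasurableSpace Y] [StandardBorelSpace Y]
    (μ : Measure X) [IsFiniteMeasure μ] {B : Set (X × Y)} (hB : MeasurableSet B)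
    (hne : ∀ x, ∃ y, (x, y) ∈ B) :
    ∃ f : X → Y, Measurable f ∧ ∀ᵐ x ∂μ, (x, f x) ∈ B := by
  classical
  let _ := upgradeStandardBorel X
  let _ := upgradeStandardBorel Y
  rcases isEmpty_or_nonempty X with hX | ⟨⟨x₀⟩⟩
  · exact ⟨fun x => isEmptyElim x, measurable_of_empty _, .of_forall fun x => isEmptyElim x⟩
  have hBa := hB.analyticSet
  rw [AnalyticSet] at hBa
  rcases hBa with rfl | ⟨F, hFc, hFB⟩
  · exact absurd (hne x₀).choose_spec (notMem_empty _)
  set p : (ℕ → ℕ) → X := fun a => (F a).1 with hp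
  have hpc : Continuous p := continuous_fst.comp hFc
  have hps : Function.Surjective p := by
    intro x
    obtain ⟨y, hy⟩ := hne x
    rw [← hFB] at hy
    obtain ⟨a, ha⟩ := hy
    exact ⟨a, by simp [hp, ha]⟩
  have hK : ∀ n : ℕ, ∃ K : Set (ℕ → ℕ), IsCompact K ∧ μ (p '' K)ᶜ ≤ (n + 1 : ENNReal)⁻¹ :=
    fun n => exists_isCompact_measure_image_compl_le μ hpc hps (by simp)
  choose K hKc hKμ using hK
  choose σ hσm hσ using fun n => exists_measurable_rightInverse_of_isCompact hpc (hKc n)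
  have hm : ∀ n, MeasurableSet (p '' K n) := fun n => ((hKc n).image hpc).measurableSet
  have hnull : μ (⋃ n, p '' K n)ᶜ = 0 := by
    refine le_antisymm (ge_of_tendsto' (x := atTop) (f := fun n : ℕ => (n + 1 : ENNReal)⁻¹) ?_ fun n =>
      (measure_mono (compl_subset_compl.mpr (subset_iUnion _ n))).trans (hKμ n)) bot_le
    have := ENNReal.tendsto_inv_nat_nhds_zero.comp (tendsto_add_atTop_nat 1)
    simpa [Function.comp_def] using this
  -- Use the first `n` whose compact image contains `x`; the second disjunct makes the search total
  -- on the remaining null set.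
  let P : ℕ → X → Prop := fun n x => x ∈ p '' K n ∨ x ∉ ⋃ n, p '' K n
  have hP : ∀ x, ∃ n, P n x := fun x => by
    by_cases hx : x ∈ ⋃ n, p '' K n
    · obtain ⟨n, hn⟩ := mem_iUnion.mp hx
      exact ⟨n, Or.inl hn⟩
    · exact ⟨0, Or.inr hx⟩
  refine ⟨fun x => (F (σ (Nat.find (hP x)) x)).2, ?_, ?_⟩
  · exact Measurable.find (p := P) (f := fun n x => (F (σ n x)).2)
      (fun n => (continuous_snd.comp hFc).measurable.comp (hσm n))
      (fun n => (hm n).union (MeasurableSet.iUnion hm).compl) hP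
  · have hae : ∀ᵐ x ∂μ, x ∈ ⋃ n, p '' K n := hnull
    filter_upwards [hae] with x hx
    have h1 : x ∈ p '' K (Nat.find (hP x)) :=
      (Nat.find_spec (hP x)).resolve_right (not_not_intro hx)
    have h2 : (F (σ (Nat.find (hP x)) x)).1 = x := hσ _ x h1
    rw [← hFB]
    exact ⟨σ (Nat.find (hP x)) x, Prod.ext h2 rfl⟩

end Selection

/-! ### Bijections assembled from countably many translated pieces -/

section Pieces

open Set

variable {G X ι : Type*} [Group G] [MeasurableSpace X] [MulAction G X] [MeasurableConstSMul G X]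
  {μ : Measure X} [SMulInvariantMeasure G X μ] [Countable ι]

/-- The complement of a null set contains a conull set that is invariant under countably many
given group elements. -/
theorem exists_conull_invariant_subset (γ : ι → G) {N : Set X} (hN : MeasurableSet N)
    (hμN : μ N = 0) :
    ∃ Z : Set X, MeasurableSet Z ∧ μ Zᶜ = 0 ∧ Disjoint Z N ∧ ∀ i x, γ i • x ∈ Z ↔ x ∈ Z := by
  -- Words in the free group run through the subgroup generated by the `γ i`, and there are only
  -- countably many of them.
  refine ⟨⋂ w : FreeGroup ι, (fun x => FreeGroup.lift γ w • x) ⁻¹' Nᶜ, ?_, ?_, ?_, ?_⟩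
  · exact MeasurableSet.iInter fun w => measurable_const_smul _ hN.compl
  · rw [compl_iInter, measure_iUnion_null_iff]
    intro w
    rw [← preimage_compl, compl_compl, measure_preimage_smul, hμN]
  · rw [disjoint_left]
    intro x hx
    simpa using mem_iInter.mp hx 1
  · intro i x
    simp only [mem_iInter, mem_preimage, smul_smul]
    constructor
    · intro h w
      simpa using h (w * (FreeGroup.of i)⁻¹)
    · intro h w
      simpa using h (w * FreeGroup.of i)

/-- Countably many pieces, moved by group elements onto countably many pieces, give up to null sets
a measure-preserving bijection which preserves all orbits. -/
theorem exists_mem_orbitBij_of_pieces (C : ι → Set X) (γ : ι → G)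
    (hC : ∀ i, MeasurableSet (C i)) (hd : Pairwise fun i j => Disjoint (C i) (C j))
    (hd' : Pairwise fun i j => Disjoint (γ i • C i) (γ j • C j))
    (hcov : μ (⋃ i, C i)ᶜ = 0) (hcov' : μ (⋃ i, γ i • C i)ᶜ = 0) :
    ∃ T ∈ orbitBij G μ, ∀ i, ∀ᵐ x ∂μ, x ∈ C i → (T : Equiv.Perm X) x = γ i • x := by
  classical
  have hC' : ∀ i, MeasurableSet (γ i • C i) := fun i => (hC i).const_smul _
  obtain ⟨Z, hZ, hZ0, hZN, hZγ⟩ := exists_conull_invariant_subset (μ := μ) γ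
    ((MeasurableSet.iUnion hC).compl.union (MeasurableSet.iUnion hC').compl)
    (measure_union_null hcov hcov')
  rw [disjoint_union_right, disjoint_compl_right_iff_subset, disjoint_compl_right_iff_subset] at hZN
  have hidx : ∀ x ∈ Z, ∃ i, x ∈ C i := fun x hx => mem_iUnion.mp (hZN.1 hx)
  have hidx' : ∀ x ∈ Z, ∃ i, x ∈ γ i • C i := fun x hx => mem_iUnion.mp (hZN.2 hx)
  -- Since `Z` is invariant under all `γ i`, the pieces permute `Z`. The identity off `Z` then gives
  -- a genuine bijection preserving every orbit, not just almost every one.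
  let t : X → X := fun x => if h : x ∈ Z then γ (hidx x h).choose • x else x
  have ht : ∀ i, ∀ x ∈ Z, x ∈ C i → t x = γ i • x := by
    intro i x hx hi
    have h : (hidx x hx).choose = i := by
      by_contra hne
      exact disjoint_left.mp (hd hne) (hidx x hx).choose_spec hi
    simp only [t, dif_pos hx, h]
  have htZ : ∀ x ∉ Z, t x = x := fun x hx => dif_neg hx
  have htmem : ∀ x, t x ∈ Z ↔ x ∈ Z := by
    intro x
    by_cases hx : x ∈ Z
    · obtain ⟨i, hi⟩ := hidx x hx
      rw [ht i x hx hi, hZγ]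
    · rw [htZ x hx]
  have hinj : Function.Injective t := by
    intro x y hxy
    by_cases hx : x ∈ Z
    · have hy : y ∈ Z := by rwa [← htmem, ← hxy, htmem]
      obtain ⟨i, hi⟩ := hidx x hx
      obtain ⟨j, hj⟩ := hidx y hy
      have hxy' := hxy
      rw [ht i x hx hi, ht j y hy hj] at hxy'
      have hij : i = j := by
        by_contra hne
        exact disjoint_left.mp (hd' hne) (smul_mem_smul_set hi)
          (hxy' ▸ smul_mem_smul_set hj)
      subst hij
      exact smul_left_cancel _ hxy'
    · have hy : y ∉ Z := by rwa [← htmem, ← hxy, htmem]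
      rwa [htZ x hx, htZ y hy] at hxy
  have hsurj : Function.Surjective t := by
    intro y
    by_cases hy : y ∈ Z
    · obtain ⟨i, x, hx, rfl⟩ := hidx' y hy
      exact ⟨x, ht i x ((hZγ i x).mp hy) hx⟩
    · exact ⟨y, htZ y hy⟩
  have hpre : ∀ S : Set X, t ⁻¹' S = (Zᶜ ∩ S) ∪ ⋃ i, (Z ∩ C i) ∩ (fun x => γ i • x) ⁻¹' S := by
    intro S
    ext x
    by_cases hx : x ∈ Z
    · obtain ⟨i, hi⟩ := hidx x hx
      simp only [mem_preimage, mem_union, mem_inter_iff, mem_compl_iff, hx, not_true, false_and,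
        false_or, mem_iUnion, true_and]
      constructor
      · intro h
        exact ⟨i, hi, by rwa [ht i x hx hi] at h⟩
      · rintro ⟨j, hj, h⟩
        rwa [ht j x hx hj]
    · simp [hx, htZ x hx]
  have himg : ∀ S : Set X, t '' S = (Zᶜ ∩ S) ∪ ⋃ i, γ i • (Z ∩ C i ∩ S) := by
    intro S
    ext y
    constructor
    · rintro ⟨x, hxS, rfl⟩
      by_cases hx : x ∈ Z
      · obtain ⟨i, hi⟩ := hidx x hx
        rw [ht i x hx hi]
        exact Or.inr (mem_iUnion.mpr ⟨i, smul_mem_smul_set ⟨⟨hx, hi⟩, hxS⟩⟩)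
      · rw [htZ x hx]
        exact Or.inl ⟨hx, hxS⟩
    · rintro (⟨hy, hyS⟩ | hy)
      · exact ⟨y, hyS, htZ y hy⟩
      · obtain ⟨i, x, ⟨⟨hx, hi⟩, hxS⟩, rfl⟩ := mem_iUnion.mp hy
        exact ⟨x, hxS, ht i x hx hi⟩
  have hpm : ∀ S, MeasurableSet S → ∀ i,
      MeasurableSet ((Z ∩ C i) ∩ (fun x => γ i • x) ⁻¹' S) := fun S hS i =>
    (hZ.inter (hC i)).inter (measurable_const_smul _ hS)
  have htm : Measurable t := fun S hS => by
    rw [hpre]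
    exact (hZ.compl.inter hS).union (MeasurableSet.iUnion (hpm S hS))
  have hmp : MeasurePreserving t μ μ := by
    refine ⟨htm, Measure.ext fun S hS => ?_⟩
    rw [Measure.map_apply htm hS]
    have h1 : ∀ S' : Set X, μ (t ⁻¹' S') = μ (Z ∩ t ⁻¹' S') := fun S' => by
      rw [inter_comm, measure_inter_conull hZ0]
    have h2 : Z ∩ t ⁻¹' S = ⋃ i, (Z ∩ C i) ∩ (fun x => γ i • x) ⁻¹' S := by
      rw [hpre, inter_union_distrib_left, ← inter_assoc, inter_compl_self, empty_inter, empty_union]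
      refine inter_eq_self_of_subset_right (iUnion_subset fun i => ?_)
      exact inter_subset_left.trans inter_subset_left
    have h3 : Z ∩ S = ⋃ i, γ i • ((Z ∩ C i) ∩ (fun x => γ i • x) ⁻¹' S) := by
      ext y
      simp only [mem_iUnion]
      constructor
      · rintro ⟨hy, hyS⟩
        obtain ⟨i, x, hx, rfl⟩ := hidx' y hy
        exact ⟨i, smul_mem_smul_set ⟨⟨(hZγ i x).mp hy, hx⟩, hyS⟩⟩
      · rintro ⟨i, x, ⟨⟨hx, -⟩, hxS⟩, rfl⟩
        exact ⟨(hZγ i x).mpr hx, hxS⟩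
    rw [h1, h2, ← measure_inter_conull (s := S) hZ0, inter_comm S Z, h3,
      measure_iUnion (fun i j hij => ((hd hij).mono (inter_subset_left.trans inter_subset_right)
        (inter_subset_left.trans inter_subset_right))) (hpm S hS),
      measure_iUnion (fun i j hij => ((hd' hij).mono
        (smul_set_mono (inter_subset_left.trans inter_subset_right))
        (smul_set_mono (inter_subset_left.trans inter_subset_right))))
        (fun i => (hpm S hS i).const_smul _)]
    simp only [measure_smul]
  let e : X ≃ᵐ X :=
    { toEquiv := Equiv.ofBijective t ⟨hinj, hsurj⟩
      measurable_toFun := htm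
      measurable_invFun := fun S hS => by
        have : (Equiv.ofBijective t ⟨hinj, hsurj⟩).symm ⁻¹' S = t '' S :=
          ((Equiv.ofBijective t ⟨hinj, hsurj⟩).image_eq_preimage_symm S).symm
        show MeasurableSet ((Equiv.ofBijective t ⟨hinj, hsurj⟩).symm ⁻¹' S)
        rw [this, himg]
        exact (hZ.compl.inter hS).union
          (MeasurableSet.iUnion fun i => ((hZ.inter (hC i)).inter hS).const_smul _) }
  have he : MeasurePreserving e μ μ := hmp
  refine ⟨⟨e.toEquiv, he, he.symm e⟩, ?_, ?_⟩
  · intro x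
    show t x ∈ MulAction.orbit G x
    by_cases hx : x ∈ Z
    · obtain ⟨i, hi⟩ := hidx x hx
      rw [ht i x hx hi]
      exact MulAction.mem_orbit _ _
    · rw [htZ x hx]
      exact MulAction.mem_orbit_self x
  · intro i
    have hZae : ∀ᵐ x ∂μ, x ∈ Z := hZ0
    filter_upwards [hZae] with x hx hi
    exact ht i x hx hi

variable [TopologicalSpace G] [IsTopologicalGroup G] [PolishSpace G]

/-- Countably many pieces, moved by group elements onto countably many pieces, define an element of
the lifted full group with countable essential image. -/
theorem exists_mem_countableRange_of_pieces (C : ι → Set X) (γ : ι → G)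
    (hC : ∀ i, MeasurableSet (C i)) (hd : Pairwise fun i j => Disjoint (C i) (C j))
    (hd' : Pairwise fun i j => Disjoint (γ i • C i) (γ j • C j))
    (hcov : μ (⋃ i, C i)ᶜ = 0) (hcov' : μ (⋃ i, γ i • C i)ᶜ = 0) :
    ∃ f ∈ Lifted.countableRange G μ, ∀ᵐ x ∂μ, ∀ i, x ∈ C i → f.1 x = γ i := by
  rcases isEmpty_or_nonempty ι with hι | hι
  · exact ⟨1, one_mem _, .of_forall fun x i => isEmptyElim i⟩
  obtain ⟨T, hT, hTC⟩ := exists_mem_orbitBij_of_pieces C γ hC hd hd' hcov hcov'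
  borelize G
  obtain ⟨g, hg, hgC⟩ := exists_measurable_piecewise C hC (fun i _ => γ i)
    (fun i => measurable_const) (fun i j hij x hx => absurd hx.2 (disjoint_left.mp (hd hij) hx.1))
  have hcae : ∀ᵐ x ∂μ, x ∈ ⋃ i, C i := hcov
  have hgs : AEStronglyMeasurable g μ := hg.aestronglyMeasurable
  have hmk := AEEqFun.coeFn_mk g hgs
  refine ⟨⟨AEEqFun.mk g hgs, T, hT, ?_⟩, ⟨range γ, countable_range γ, ?_⟩, ?_⟩
  · filter_upwards [hcae, hmk, ae_all_iff.mpr hTC] with x hx h1 h2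
    obtain ⟨i, hi⟩ := mem_iUnion.mp hx
    rw [h1, h2 i hi, hgC i hi]
  · filter_upwards [hcae, hmk] with x hx h1
    obtain ⟨i, hi⟩ := mem_iUnion.mp hx
    show (AEEqFun.mk g hgs : X → G) x ∈ range γ
    rw [h1, hgC i hi]
    exact mem_range_self i
  · filter_upwards [hmk] with x h1 i hi
    show (AEEqFun.mk g hgs : X → G) x = γ i
    rw [h1, hgC i hi]

end Pieces

/-! ### Surjectivity of `Φ`, fullness and minimality -/

section Full

open Set

variable {G X : Type*} [Group G] [TopologicalSpace G] [IsTopologicalGroup G] [PolishSpace G]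
  [MeasurableSpace G] [MeasurableSpace X]
  {μ : Measure X} [MulAction G X] [MeasurableSMul₂ G X]

/-- The relation `g • x = T x` is Borel with nonempty sections, and a uniformizing function is a
lift of `T`. -/
theorem PhiOrbit_surjective [BorelSpace G] [StandardBorelSpace X] [IsFiniteMeasure μ] :
    Function.Surjective (Lifted.PhiOrbit G μ) := by
  rintro ⟨_, T, hT, rfl⟩
  have hB : MeasurableSet {q : X × G | q.2 • q.1 = (T : Equiv.Perm X) q.1} :=
    measurableSet_eq_fun (measurable_snd.smul measurable_fst) ((mp T).measurable.comp measurable_fst)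
  obtain ⟨f, hf, hfT⟩ := exists_measurable_ae_mem_of_sections_nonempty μ hB fun x => hT x
  have hmk := AEEqFun.coeFn_mk f (hf.aestronglyMeasurable (μ := μ))
  have hspec : ∀ᵐ x ∂μ, (AEEqFun.mk f (hf.aestronglyMeasurable (μ := μ)) : X → G) x • x =
      (T : Equiv.Perm X) x := by
    filter_upwards [hmk, hfT] with x h1 h2
    rw [h1]
    exact h2
  refine ⟨⟨AEEqFun.mk f hf.aestronglyMeasurable, T, hT, hspec⟩, Subtype.ext ?_⟩
  exact (Lifted.Phi_eq_iff _ T).mpr hspec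

variable [SMulInvariantMeasure G X μ]

/-- Cut each `A n` further by the value of a countable-valued lift of `S n`. On every piece `T` is
translation by one group element, and the translated pieces are disjoint because `T` is injective.
-/
theorem isFull_map_Phi_countableRange [BorelSpace G] [StandardBorelSpace X] :
    IsFull ((Lifted.countableRange G μ).map (Lifted.Phi G μ)) := by
  intro A S T hA hAd hAcov hS hTS
  choose f hf hfS using hS
  choose c hc hfc using hf
  have : ∀ n, Countable (c n) := fun n => (hc n).to_subtype
  let C : (Σ n, c n) → Set X := fun i =>
    A i.1 ∩ {x | (f i.1).1 x = i.2} ∩ {x | (T : Equiv.Perm X) x = (i.2 : G) • x}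
  have hC : ∀ i, MeasurableSet (C i) := fun i =>
    ((hA i.1).inter ((f i.1).1.measurable (measurableSet_singleton _))).inter
      (measurableSet_eq_fun (mp T).measurable (measurable_const_smul _))
  have hCd : Pairwise fun i j => Disjoint (C i) (C j) := by
    rintro ⟨m, a⟩ ⟨n, b⟩ hij
    rw [disjoint_left]
    rintro x ⟨⟨h1, h2⟩, -⟩ ⟨⟨h3, h4⟩, -⟩
    by_cases hmn : m = n
    · subst hmn
      exact hij (by rw [Subtype.ext (a1 := a) (a2 := b) (h2.symm.trans h4)])
    · exact disjoint_left.mp (hAd hmn) h1 h3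
  have himg : ∀ i : Σ n, c n, (i.2 : G) • C i = (T : Equiv.Perm X) '' C i := fun i =>
    image_congr fun x hx => hx.2.symm
  have hae : ∀ᵐ x ∂μ, x ∈ ⋃ i, C i := by
    have hAae : ∀ᵐ x ∂μ, x ∈ ⋃ n, A n := hAcov
    filter_upwards [hAae, ae_all_iff.mpr hTS, ae_all_iff.mpr hfc,
      ae_all_iff.mpr fun n => (Lifted.Phi_eq_iff (f n) (S n)).mp (hfS n)] with x h1 h2 h3 h4
    obtain ⟨n, hn⟩ := mem_iUnion.mp h1
    exact mem_iUnion.mpr ⟨⟨n, ⟨_, h3 n⟩⟩, ⟨⟨hn, rfl⟩, (h2 n hn).trans (h4 n).symm⟩⟩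
  obtain ⟨g, hg, hgC⟩ := exists_mem_countableRange_of_pieces (μ := μ) C (fun i => (i.2 : G)) hC hCd
    (fun i j hij => by
      simp only [himg]
      exact (disjoint_image_iff (T : Equiv.Perm X).injective).mpr (hCd hij))
    hae
    (by
      simp only [himg]
      rw [← image_iUnion, ← image_compl_eq (T : Equiv.Perm X).bijective,
        Equiv.image_eq_preimage_symm]
      exact (mp_symm T).quasiMeasurePreserving.preimage_null hae)
  refine ⟨g, hg, (Lifted.Phi_eq_iff g T).mpr ?_⟩
  filter_upwards [hae, hgC] with x h1 h2
  obtain ⟨i, hi⟩ := mem_iUnion.mp h1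
  rw [h2 i hi]
  exact hi.2.symm

theorem range_actionHom_le_map_Phi_countableRange :
    (actionHom G μ).range ≤ (Lifted.countableRange G μ).map (Lifted.Phi G μ) := by
  rintro _ ⟨g, rfl⟩
  obtain ⟨f, hf, hfg⟩ := exists_mem_countableRange_of_pieces (μ := μ) (fun _ : Unit => univ)
    (fun _ => g) (fun _ => MeasurableSet.univ) (fun i j hij => absurd rfl hij)
    (fun i j hij => absurd rfl hij) (by rw [iUnion_const]; simp) (by rw [iUnion_const]; simp)
  refine ⟨f, hf, (Lifted.Phi_eq_iff f _).mpr ?_⟩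
  filter_upwards [hfg] with x hx
  rw [hx () (mem_univ x)]
  rfl

/-- A countable-valued `f` is pasted from the translations by its values, along the level sets of
`f`. -/
theorem map_Phi_countableRange_le_of_isFull [BorelSpace G] {K : Subgroup (Aut μ)} (hK : IsFull K)
    (hGK : (actionHom G μ).range ≤ K) :
    (Lifted.countableRange G μ).map (Lifted.Phi G μ) ≤ K := by
  rintro _ ⟨f, ⟨c, hc, hfc⟩, rfl⟩
  -- Adding `1` makes the set nonempty, so a sequence enumerates it. Values may repeat, hence
  -- `disjointed` below.
  obtain ⟨u, hu⟩ := (hc.insert 1).exists_eq_range (insert_nonempty _ _)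
  have hmeas : ∀ n, MeasurableSet {x | f.1 x = u n} := fun n =>
    f.1.measurable (measurableSet_singleton _)
  refine hK (disjointed fun n => {x | f.1 x = u n})
    (fun n => ⟨MulAction.toPerm (u n), measurePreserving_smul _ μ, measurePreserving_smul _ μ⟩)
    f.bij (fun n => MeasurableSet.disjointed hmeas n) (disjoint_disjointed _) ?_
    (fun n => hGK ⟨u n, rfl⟩) ?_
  · rw [iUnion_disjointed]
    show ∀ᵐ x ∂μ, x ∈ ⋃ n, {x | f.1 x = u n}
    filter_upwards [hfc] with x hx
    have : f.1 x ∈ range u := hu ▸ mem_insert_of_mem _ hx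
    obtain ⟨n, hn⟩ := this
    exact mem_iUnion.mpr ⟨n, hn.symm⟩
  · intro n
    filter_upwards [f.bij_spec] with x hx hxn
    have h : f.1 x = u n := disjointed_subset _ n hxn
    rw [← hx, h]
    rfl

end Full

/-! ### One null set for uncountably many group elements -/

section Suitable

open Set

variable {G X : Type*} [Group G] [TopologicalSpace G] [IsTopologicalGroup G] [PolishSpace G]
  [MeasurableSpace G] [MeasurableSpace X]
  {μ : Measure X} [MulAction G X] [MeasurableSMul₂ G X] [SMulInvariantMeasure G X μ]

/-- If no element of an open set `P` moves a positive part of `A` into `B`, then for a suitable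
action the elements of `P` move no point of `A` into `B`, up to a null set independent of the
element. -/
theorem IsSuitable.exists_null_forall_smul_notMem (hsuit : IsSuitable G μ) {P : Set G}
    (hP : IsOpen P) {A B : Set X} (hA : MeasurableSet A) (hB : MeasurableSet B)
    (h : ∀ g ∈ P, μ (A ∩ (fun x => g • x) ⁻¹' B) = 0) :
    ∃ N : Set X, MeasurableSet N ∧ μ N = 0 ∧ ∀ g ∈ P, ∀ x ∈ A \ N, g • x ∉ B \ N := by
  rcases eq_or_ne (μ A) 0 with hA0 | hA0
  · exact ⟨A, hA, hA0, by simp⟩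
  rcases eq_or_ne (μ B) 0 with hB0 | hB0
  · exact ⟨B, hB, hB0, by simp⟩
  -- Suitability of `w • A` and `B` settles a neighbourhood of `w`. Its first alternative would give
  -- `g` near `1` with `g⁻¹ * w ∈ P` moving a positive part of `A` into `B`.
  have key : ∀ w ∈ P, ∃ (N : Set X) (O : Set G), MeasurableSet N ∧ μ N = 0 ∧ IsOpen O ∧ (1 : G) ∈ O ∧
      ∀ o ∈ O, ∀ x ∈ A \ N, (o * w) • x ∉ B \ N := by
    intro w hw
    rcases hsuit (w • A) B (hA.const_smul w) hB (by rw [measure_smul]; exact hA0.bot_lt)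
      hB0.bot_lt with h1 | ⟨A', B', hA'A, hB'B, hA', hB', hμA, hμB, O, hO, h1O, hOAB⟩
    · obtain ⟨g, hg, hpos⟩ := h1 ((fun g => g⁻¹ * w) ⁻¹' P)
        (hP.preimage (continuous_inv.mul continuous_const)) (by simpa using hw)
      refine absurd (h _ hg) (ne_of_gt ?_)
      rw [← measure_smul μ g⁻¹] at hpos
      rw [← measure_smul μ (g⁻¹ * w)]
      refine hpos.trans_le (measure_mono ?_)
      rintro _ ⟨_, ⟨⟨a, ha, rfl⟩, ⟨b, hb, hab⟩⟩, rfl⟩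
      have hab' : g • b = w • a := hab
      refine ⟨a, ⟨ha, ?_⟩, ?_⟩
      · show (g⁻¹ * w) • a ∈ B
        rw [mul_smul, ← hab', inv_smul_smul]
        exact hb
      · show (g⁻¹ * w) • a = g⁻¹ • w • a
        rw [mul_smul]
    · refine ⟨w⁻¹ • (w • A \ A') ∪ (B \ B'), O, ?_, ?_, hO, h1O, ?_⟩
      · exact (((hA.const_smul w).diff hA').const_smul _).union (hB.diff hB')
      · exact measure_union_null (by rw [measure_smul, hμA]) hμB
      · rintro o ho x ⟨hxA, hxN⟩ ⟨hB1, hB2⟩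
        have h1 : w • x ∈ A' := by
          by_contra hcon
          exact hxN (Or.inl ⟨w • x, ⟨smul_mem_smul_set hxA, hcon⟩, inv_smul_smul w x⟩)
        have h2 : (o * w) • x ∈ B' := by
          by_contra hcon
          exact hB2 (Or.inr ⟨hB1, hcon⟩)
        have h3 : (o * w) • x ∈ (O • A') ∩ B' := ⟨by rw [mul_smul]; exact smul_mem_smul ho h1, h2⟩
        rw [hOAB] at h3
        exact h3
  choose! N O hN hN0 hO h1O hNO using key
  -- By the Lindelöf property countably many of the neighbourhoods `O w * w` cover `P`.
  obtain ⟨t, htP, htc, htcov⟩ := TopologicalSpace.countable_cover_nhdsWithin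
    (f := fun w => (fun g => g * w⁻¹) ⁻¹' O w) (s := P) fun w hw =>
      mem_nhdsWithin_of_mem_nhds (((hO w hw).preimage (continuous_mul_const _)).mem_nhds
        (by simpa using h1O w hw))
  refine ⟨⋃ w ∈ t, N w, MeasurableSet.biUnion htc fun w hw => hN w (htP hw),
    (measure_biUnion_null_iff htc).mpr fun w hw => hN0 w (htP hw), ?_⟩
  rintro g hg x ⟨hxA, hxN⟩ ⟨hB1, hB2⟩
  obtain ⟨w, hw, hgw⟩ := mem_iUnion₂.mp (htcov hg)
  simp only [mem_iUnion, not_exists] at hxN hB2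
  refine hNO w (htP hw) _ hgw x ⟨hxA, hxN w hw⟩ ?_
  rw [inv_mul_cancel_right]
  exact ⟨hB1, hB2 w hw⟩

end Suitable

/-! ### A single maximal matching by exhaustion -/

section Greedy

open Set

variable {G X : Type*} [Group G] [MeasurableSpace X] [MulAction G X] [MeasurableConstSMul G X]
  {μ : Measure X}

/-- Exhaustion: given a set of moves `(Y, g)`, each consisting of a measurable domain and a group
element, match parts of `A` to parts of `B` until no move takes a positive part of what remains of
`A` to what remains of `B`. -/
theorem exists_maximal_matching [IsFiniteMeasure μ] {Q : Set (Set X × G)} (hQ : Q.Nonempty)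
    (hQm : ∀ q ∈ Q, MeasurableSet q.1) {A B : Set X} (hA : MeasurableSet A)
    (hB : MeasurableSet B) :
    ∃ (q : ℕ → Set X × G) (C : ℕ → Set X), (∀ k, q k ∈ Q) ∧ (∀ k, MeasurableSet (C k)) ∧
      (∀ k, C k ⊆ A) ∧ (∀ k, C k ⊆ (q k).1) ∧ (∀ k, (q k).2 • C k ⊆ B) ∧
      (Pairwise fun k l => Disjoint (C k) (C l)) ∧
      (Pairwise fun k l => Disjoint ((q k).2 • C k) ((q l).2 • C l)) ∧
      ∀ r ∈ Q, μ ((A \ ⋃ k, C k) ∩ r.1 ∩ (fun x => r.2 • x) ⁻¹' (B \ ⋃ k, (q k).2 • C k)) = 0 := by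
  let piece : Set X × G → Set X × Set X → Set X := fun q s =>
    s.1 ∩ q.1 ∩ (fun x => q.2 • x) ⁻¹' s.2
  -- The supremum over the possibly uncountable `Q` need not be attained, so settle for half of it.
  have hpick : ∀ s : Set X × Set X, ∃ q ∈ Q, ∀ r ∈ Q, μ (piece r s) ≤ 2 * μ (piece q s) := by
    intro s
    obtain ⟨q₀, hq₀⟩ := hQ
    set c := ⨆ q ∈ Q, μ (piece q s) with hc
    have hle : ∀ r ∈ Q, μ (piece r s) ≤ c := fun r hr => le_iSup₂ (f := fun q _ => μ (piece q s)) r hr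
    rcases eq_or_ne c 0 with h0 | h0
    · exact ⟨q₀, hq₀, fun r hr => (hle r hr).trans (h0 ▸ bot_le)⟩
    · have hfin : c ≠ ⊤ := ne_top_of_le_ne_top (measure_ne_top μ univ)
        (iSup₂_le fun q _ => measure_mono (subset_univ _))
      obtain ⟨q, hq⟩ := lt_iSup_iff.mp (ENNReal.half_lt_self h0 hfin)
      obtain ⟨hqQ, hq⟩ := lt_iSup_iff.mp hq
      refine ⟨q, hqQ, fun r hr => (hle r hr).trans ?_⟩
      rw [mul_comm, ← ENNReal.div_le_iff_le_mul (Or.inl two_ne_zero) (Or.inl ENNReal.ofNat_ne_top)]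
      exact hq.le
  choose pick hpickQ hpick using hpick
  let s : ℕ → Set X × Set X := fun k => Nat.rec (A, B)
    (fun _ s => (s.1 \ piece (pick s) s, s.2 \ (pick s).2 • piece (pick s) s)) k
  set q : ℕ → Set X × G := fun k => pick (s k) with hq
  set C : ℕ → Set X := fun k => piece (q k) (s k) with hC
  have hs1 : ∀ k, (s (k + 1)).1 = (s k).1 \ C k := fun k => rfl
  have hs2 : ∀ k, (s (k + 1)).2 = (s k).2 \ (q k).2 • C k := fun k => rfl
  have hanti1 : Antitone fun k => (s k).1 := antitone_nat_of_succ_le fun k => by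
    rw [hs1]; exact sdiff_subset
  have hanti2 : Antitone fun k => (s k).2 := antitone_nat_of_succ_le fun k => by
    rw [hs2]; exact sdiff_subset
  have hC1 : ∀ k, C k ⊆ (s k).1 := fun k => inter_subset_left.trans inter_subset_left
  have hC2 : ∀ k, (q k).2 • C k ⊆ (s k).2 := by
    rintro k _ ⟨x, hx, rfl⟩
    exact hx.2
  have hsm : ∀ k, MeasurableSet (s k).1 ∧ MeasurableSet (s k).2 ∧ MeasurableSet (C k) := by
    have hCm : ∀ k, MeasurableSet (s k).1 → MeasurableSet (s k).2 → MeasurableSet (C k) :=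
      fun k h1 h2 => (h1.inter (hQm _ (hpickQ _))).inter (measurable_const_smul _ h2)
    intro k
    induction k with
    | zero => exact ⟨hA, hB, hCm 0 hA hB⟩
    | succ k ih =>
      have h1 : MeasurableSet (s (k + 1)).1 := ih.1.diff ih.2.2
      have h2 : MeasurableSet (s (k + 1)).2 := ih.2.1.diff (ih.2.2.const_smul _)
      exact ⟨h1, h2, hCm (k + 1) h1 h2⟩
  have hd1 : Pairwise fun k l => Disjoint (C k) (C l) := by
    refine (pairwise_disjoint_on C).mpr fun k l hkl => disjoint_left.mpr fun x hx hx' => ?_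
    have h : x ∈ (s k).1 \ C k := hanti1 hkl (hC1 l hx')
    exact h.2 hx
  have hd2 : Pairwise fun k l => Disjoint ((q k).2 • C k) ((q l).2 • C l) := by
    refine (pairwise_disjoint_on fun k => (q k).2 • C k).mpr fun k l hkl =>
      disjoint_left.mpr fun x hx hx' => ?_
    have h : x ∈ (s k).2 \ (q k).2 • C k := hanti2 hkl (hC2 l hx')
    exact h.2 hx
  have hsub1 : ∀ k, A \ ⋃ k, C k ⊆ (s k).1 := by
    intro k
    induction k with
    | zero => exact sdiff_subset
    | succ k ih =>
      rw [hs1]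
      exact fun x hx => ⟨ih hx, fun h => hx.2 (mem_iUnion.mpr ⟨k, h⟩)⟩
  have hsub2 : ∀ k, B \ ⋃ k, (q k).2 • C k ⊆ (s k).2 := by
    intro k
    induction k with
    | zero => exact sdiff_subset
    | succ k ih =>
      rw [hs2]
      exact fun x hx => ⟨ih hx, fun h => hx.2 (mem_iUnion.mpr ⟨k, h⟩)⟩
  refine ⟨q, C, fun k => hpickQ _, fun k => (hsm k).2.2, fun k => (hC1 k).trans (hanti1 (Nat.zero_le k)),
    fun k => inter_subset_left.trans inter_subset_right,
    fun k => (hC2 k).trans (hanti2 (Nat.zero_le k)), hd1, hd2, fun r hr => ?_⟩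
  -- The pieces are disjoint, so `μ (C k)` tends to zero, and twice it bounds what any move could
  -- still match.
  have hsum : ∑' k, μ (C k) ≠ ⊤ := by
    rw [← measure_iUnion hd1 fun k => (hsm k).2.2]
    exact measure_ne_top _ _
  have hlim := ENNReal.Tendsto.const_mul (a := 2)
    (ENNReal.tendsto_atTop_zero_of_tsum_ne_top hsum) (Or.inr ENNReal.ofNat_ne_top)
  rw [mul_zero] at hlim
  refine le_antisymm (ge_of_tendsto' hlim fun k => ?_) bot_le
  refine (measure_mono ?_).trans (hpick (s k) r hr)
  exact inter_subset_inter (inter_subset_inter_left _ (hsub1 k)) (preimage_mono (hsub2 k))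

end Greedy

/-! ### Successive rounds of matching -/

section GreedyMatching

open Set

variable {G X : Type*} [Group G] [MeasurableSpace X] [MulAction G X]

/-- Successive maximal matchings, the `j`-th with moves from `Q j`, between what the preceding ones
have left of two sets. -/
structure GreedyMatching (μ : Measure X) (Q : ℕ → Set (Set X × G)) (A₀ B₀ : Set X) where
  /-- what is left of the first set after `j` rounds -/
  A : ℕ → Set X
  /-- what is left of the second set after `j` rounds -/
  B : ℕ → Set X
  /-- the moves of round `j` -/
  move : ℕ → ℕ → Set X × G
  /-- the pieces moved in round `j` -/
  piece : ℕ → ℕ → Set X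
  A_zero : A 0 = A₀
  B_zero : B 0 = B₀
  measurableSet_A : ∀ j, MeasurableSet (A j)
  measurableSet_B : ∀ j, MeasurableSet (B j)
  move_mem : ∀ j k, move j k ∈ Q j
  measurableSet_piece : ∀ j k, MeasurableSet (piece j k)
  piece_subset : ∀ j k, piece j k ⊆ A j
  piece_subset_move : ∀ j k, piece j k ⊆ (move j k).1
  smul_piece_subset : ∀ j k, (move j k).2 • piece j k ⊆ B j
  disjoint_piece : ∀ j, Pairwise fun k l => Disjoint (piece j k) (piece j l)
  disjoint_smul_piece : ∀ j, Pairwise fun k l =>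
    Disjoint ((move j k).2 • piece j k) ((move j l).2 • piece j l)
  A_succ : ∀ j, A (j + 1) = A j \ ⋃ k, piece j k
  B_succ : ∀ j, B (j + 1) = B j \ ⋃ k, (move j k).2 • piece j k
  maximal : ∀ j, ∀ q ∈ Q j, μ (A (j + 1) ∩ q.1 ∩ (fun x => q.2 • x) ⁻¹' B (j + 1)) = 0

theorem nonempty_greedyMatching [MeasurableConstSMul G X] {μ : Measure X}
    [IsFiniteMeasure μ] {Q : ℕ → Set (Set X × G)}
    (hQ : ∀ j, (Q j).Nonempty) (hQm : ∀ j, ∀ q ∈ Q j, MeasurableSet q.1) {A₀ B₀ : Set X}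
    (hA : MeasurableSet A₀) (hB : MeasurableSet B₀) :
    Nonempty (GreedyMatching μ Q A₀ B₀) := by
  choose q C hqQ hCm hCA hCq hCB hd hd' hmax using
    fun (j : ℕ) (s : {s : Set X × Set X // MeasurableSet s.1 ∧ MeasurableSet s.2}) =>
      exists_maximal_matching (μ := μ) (hQ j) (hQm j) s.2.1 s.2.2
  let s : ℕ → {s : Set X × Set X // MeasurableSet s.1 ∧ MeasurableSet s.2} := fun j =>
    Nat.rec ⟨(A₀, B₀), hA, hB⟩ (fun j s => ⟨(s.1.1 \ ⋃ k, C j s k, s.1.2 \ ⋃ k, (q j s k).2 • C j s k),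
      s.2.1.diff (MeasurableSet.iUnion (hCm j s)),
      s.2.2.diff (MeasurableSet.iUnion fun k => (hCm j s k).const_smul _)⟩) j
  exact ⟨{
    A := fun j => (s j).1.1
    B := fun j => (s j).1.2
    move := fun j => q j (s j)
    piece := fun j => C j (s j)
    A_zero := rfl
    B_zero := rfl
    measurableSet_A := fun j => (s j).2.1
    measurableSet_B := fun j => (s j).2.2
    move_mem := fun j => hqQ j (s j)
    measurableSet_piece := fun j => hCm j (s j)
    piece_subset := fun j => hCA j (s j)
    piece_subset_move := fun j => hCq j (s j)
    smul_piece_subset := fun j => hCB j (s j)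
    disjoint_piece := fun j => hd j (s j)
    disjoint_smul_piece := fun j => hd' j (s j)
    A_succ := fun j => rfl
    B_succ := fun j => rfl
    maximal := fun j => hmax j (s j) }⟩

namespace GreedyMatching

variable {μ : Measure X} {Q : ℕ → Set (Set X × G)} {A₀ B₀ : Set X} (D : GreedyMatching μ Q A₀ B₀)

theorem antitone_A : Antitone D.A :=
  antitone_nat_of_succ_le fun j => by rw [D.A_succ]; exact sdiff_subset

theorem antitone_B : Antitone D.B :=
  antitone_nat_of_succ_le fun j => by rw [D.B_succ]; exact sdiff_subset

theorem notMem_A_of_mem_piece {j k l : ℕ} {x : X} (hx : x ∈ D.piece j k) (hjl : j < l) :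
    x ∉ D.A l := fun h => by
  have := D.antitone_A hjl h
  rw [D.A_succ] at this
  exact this.2 (mem_iUnion.mpr ⟨k, hx⟩)

theorem notMem_B_of_mem_smul_piece {j k l : ℕ} {x : X} (hx : x ∈ (D.move j k).2 • D.piece j k)
    (hjl : j < l) : x ∉ D.B l := fun h => by
  have := D.antitone_B hjl h
  rw [D.B_succ] at this
  exact this.2 (mem_iUnion.mpr ⟨k, hx⟩)

theorem exists_mem_piece {x : X} (hx : x ∈ A₀) {l : ℕ} (hxl : x ∉ D.A l) :
    ∃ j < l, ∃ k, x ∈ D.piece j k := by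
  induction l with
  | zero => exact absurd (D.A_zero.symm ▸ hx : x ∈ D.A 0) hxl
  | succ l ih =>
    by_cases h : x ∈ D.A l
    · rw [D.A_succ] at hxl
      obtain ⟨k, hk⟩ := mem_iUnion.mp (not_not.mp fun hcon => hxl ⟨h, hcon⟩)
      exact ⟨l, l.lt_succ_self, k, hk⟩
    · obtain ⟨j, hj, hk⟩ := ih h
      exact ⟨j, hj.trans l.lt_succ_self, hk⟩

theorem exists_mem_smul_piece {x : X} (hx : x ∈ B₀) {l : ℕ} (hxl : x ∉ D.B l) :
    ∃ j < l, ∃ k, x ∈ (D.move j k).2 • D.piece j k := by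
  induction l with
  | zero => exact absurd (D.B_zero.symm ▸ hx : x ∈ D.B 0) hxl
  | succ l ih =>
    by_cases h : x ∈ D.B l
    · rw [D.B_succ] at hxl
      obtain ⟨k, hk⟩ := mem_iUnion.mp (not_not.mp fun hcon => hxl ⟨h, hcon⟩)
      exact ⟨l, l.lt_succ_self, k, hk⟩
    · obtain ⟨j, hj, hk⟩ := ih h
      exact ⟨j, hj.trans l.lt_succ_self, hk⟩

theorem pairwise_disjoint_piece :
    Pairwise fun i i' : ℕ × ℕ => Disjoint (D.piece i.1 i.2) (D.piece i'.1 i'.2) := by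
  rintro ⟨j, k⟩ ⟨j', k'⟩ hne
  rcases lt_trichotomy j j' with h | rfl | h
  · exact disjoint_left.mpr fun x hx hx' => D.notMem_A_of_mem_piece hx h (D.piece_subset _ _ hx')
  · exact D.disjoint_piece j fun h => hne (Prod.ext rfl h)
  · exact disjoint_left.mpr fun x hx hx' => D.notMem_A_of_mem_piece hx' h (D.piece_subset _ _ hx)

theorem pairwise_disjoint_smul_piece :
    Pairwise fun i i' : ℕ × ℕ => Disjoint ((D.move i.1 i.2).2 • D.piece i.1 i.2)
      ((D.move i'.1 i'.2).2 • D.piece i'.1 i'.2) := by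
  rintro ⟨j, k⟩ ⟨j', k'⟩ hne
  rcases lt_trichotomy j j' with h | rfl | h
  · exact disjoint_left.mpr fun x hx hx' =>
      D.notMem_B_of_mem_smul_piece hx h (D.smul_piece_subset _ _ hx')
  · exact D.disjoint_smul_piece j fun h => hne (Prod.ext rfl h)
  · exact disjoint_left.mpr fun x hx hx' =>
      D.notMem_B_of_mem_smul_piece hx' h (D.smul_piece_subset _ _ hx)

end GreedyMatching

end GreedyMatching

/-! ### Alternating paths and approximation by countable-valued elements -/

section Approximation

open Set Filter Topology

/-- A neighbourhood scale: open sets growing fast enough for each of them to absorb the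
displacements that alternate between two smaller ones. -/
structure IsScale {G : Type*} [Group G] [TopologicalSpace G] (W : ℕ → Set G) : Prop where
  isOpen : ∀ j, IsOpen (W j)
  one_mem : (1 : G) ∈ W 0
  mono : Monotone W
  mul_inv_mul_mem : ∀ j, ∀ a ∈ W 0, ∀ b ∈ W j, ∀ c ∈ W j, a * b⁻¹ * c ∈ W (j + 1)

/-- Take `W j = S ^ 3 ^ j` with `S` symmetric and `S ^ (3 ^ m + 1) ⊆ U`: a product of three factors
from `W j` lies in `W (j + 1)`, and the extra `1` pays for the factor from `W 0`. -/
theorem exists_isScale {G : Type*} [Group G] [TopologicalSpace G] [IsTopologicalGroup G]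
    {U : Set G} (hU : U ∈ 𝓝 1) (m : ℕ) :
    ∃ W : ℕ → Set G, IsScale W ∧ ∀ a ∈ W m, ∀ b ∈ W 0, a * b⁻¹ ∈ U := by
  have hpow : ∀ (n : ℕ) (U : Set G), U ∈ 𝓝 1 → ∃ V : Set G, IsOpen V ∧ 1 ∈ V ∧ V ^ n ⊆ U := by
    intro n
    induction n with
    | zero =>
      intro U hU
      exact ⟨univ, isOpen_univ, mem_univ _, by simpa using mem_of_mem_nhds hU⟩
    | succ n ih =>
      intro U hU
      obtain ⟨U', hU'o, hU'1, hU'⟩ := exists_open_nhds_one_mul_subset hU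
      obtain ⟨V, hV, hV1, hVU⟩ := ih U' (hU'o.mem_nhds hU'1)
      refine ⟨V ∩ U', hV.inter hU'o, ⟨hV1, hU'1⟩, ?_⟩
      rw [pow_succ]
      exact (mul_subset_mul ((pow_subset_pow_left inter_subset_left).trans hVU)
        inter_subset_right).trans hU'
  obtain ⟨V, hV, hV1, hVU⟩ := hpow (3 ^ m + 1) U hU
  set S := V ∩ V⁻¹ with hS
  have hSo : IsOpen S := hV.inter hV.inv
  have hS1 : (1 : G) ∈ S := ⟨hV1, by simpa using hV1⟩
  have hSinv : S⁻¹ = S := by rw [hS, inter_inv, inv_inv, inter_comm]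
  have hSpinv : ∀ n, ∀ b ∈ S ^ n, b⁻¹ ∈ S ^ n := fun n b hb => by
    rw [← hSinv, inv_pow]
    exact inv_mem_inv.mpr hb
  have hmono : ∀ {k l : ℕ}, k ≤ l → S ^ k ⊆ S ^ l := fun h => pow_subset_pow_right hS1 h
  refine ⟨fun j => S ^ 3 ^ j, ⟨fun j => ?_, by simpa using hS1, fun i j hij =>
    hmono (Nat.pow_le_pow_right (by norm_num) hij), ?_⟩, ?_⟩
  · have : ∀ n, n ≠ 0 → IsOpen (S ^ n) := fun n hn => by
      obtain ⟨k, rfl⟩ := Nat.exists_eq_succ_of_ne_zero hn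
      rw [Nat.succ_eq_add_one, pow_succ]
      exact hSo.mul_left
    exact this _ (by positivity)
  · intro j a ha b hb c hc
    have ha' : a ∈ S ^ 3 ^ j := hmono (Nat.pow_le_pow_right (by norm_num) (Nat.zero_le j)) ha
    have := mul_mem_mul (mul_mem_mul ha' (hSpinv _ b hb)) hc
    rw [← pow_add, ← pow_add] at this
    refine hmono ?_ this
    rw [pow_succ]
    omega
  · intro a ha b hb
    refine hVU (pow_subset_pow_left (s := S) inter_subset_left ?_)
    have hb' : b ∈ S := by simpa using hb
    rw [pow_succ]
    exact mul_mem_mul ha (by rw [← hSinv]; exact inv_mem_inv.mpr hb')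

/-- The moves `g` of the points `x` for which `g` and `f x` are close to the same `g n`, at scales
`j` and `0`. -/
def nearMoves {G X : Type*} [Group G] (f : X → G) (g : ℕ → G) (W : ℕ → Set G) (j : ℕ) :
    Set (Set X × G) :=
  {q | ∃ n, q.1 = {x | f x * (g n)⁻¹ ∈ W 0} ∧ q.2 * (g n)⁻¹ ∈ W j}

variable {G X : Type*} [Group G] [TopologicalSpace G] [IsTopologicalGroup G] [PolishSpace G]
  [MeasurableSpace G] [BorelSpace G] [MeasurableSpace X]
  {μ : Measure X} [MulAction G X] [MeasurableSMul₂ G X] [SMulInvariantMeasure G X μ]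

/-- For a suitable action, what is left after `m` rounds of matching by near moves has measure at
most `1 / (m + 1)`. -/
theorem GreedyMatching.mul_measure_A_le (hsuit : IsSuitable G μ) {f : X → G} (hf : Measurable f)
    {g : ℕ → G} {W : ℕ → Set G} (hW : IsScale W) (hg : ∀ h, ∃ n, h * (g n)⁻¹ ∈ W 0)
    (T : MPBij μ) {A₀ : Set X} (hA₀ : ∀ x ∈ A₀, f x • x = (T : Equiv.Perm X) x)
    (D : GreedyMatching μ (nearMoves f g W) A₀ univ) (m : ℕ) :
    (m + 1) * μ (D.A m) ≤ μ univ := by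
  have hY : ∀ n, MeasurableSet {x | f x * (g n)⁻¹ ∈ W 0} := fun n =>
    (hf.mul_const _) (hW.isOpen 0).measurableSet
  have hN : ∀ j n, ∃ N : Set X, MeasurableSet N ∧ μ N = 0 ∧ ∀ γ, γ * (g n)⁻¹ ∈ W j →
      ∀ x ∈ (D.A (j + 1) ∩ {x | f x * (g n)⁻¹ ∈ W 0}) \ N, γ • x ∉ D.B (j + 1) \ N := fun j n =>
    hsuit.exists_null_forall_smul_notMem
      (P := (fun γ => γ * (g n)⁻¹) ⁻¹' W j) ((hW.isOpen j).preimage (continuous_mul_const _))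
      ((D.measurableSet_A _).inter (hY n)) (D.measurableSet_B _)
      fun γ hγ => D.maximal j ({x | f x * (g n)⁻¹ ∈ W 0}, γ) ⟨n, rfl, hγ⟩
  choose N' hN'm hN'0 hN' using hN
  set N := ⋃ j, ⋃ n, N' j n with hNdef
  have hNm : MeasurableSet N := MeasurableSet.iUnion fun j => MeasurableSet.iUnion fun n => hN'm j n
  have hN0 : μ N = 0 := measure_iUnion_null fun j => measure_iUnion_null fun n => hN'0 j n
  have hN : ∀ j n γ x, γ * (g n)⁻¹ ∈ W j → f x * (g n)⁻¹ ∈ W 0 → x ∈ D.A (j + 1) → x ∉ N →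
      γ • x ∉ N → γ • x ∉ D.B (j + 1) := by
    intro j n γ x h1 h2 h3 h4 h5 h6
    have hsub : N' j n ⊆ N := subset_iUnion₂ (s := fun j n => N' j n) j n
    exact hN' j n γ h1 x ⟨⟨h3, h2⟩, fun h => h4 (hsub h)⟩ ⟨h6, fun h => h5 (hsub h)⟩
  have hmA : ∀ j, MeasurableSet (D.A j) := D.measurableSet_A
  have hAA₀ : ∀ j, D.A j ⊆ A₀ := fun j x hx => by
    rw [← D.A_zero]
    exact D.antitone_A j.zero_le hx
  -- `S` consists of points reached from `D.A m` by at most `j` alternations; `γ` is the accumulated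
  -- group element from the starting point `x` to `T s`.
  have key : ∀ j ≤ m, ∃ S : Set X, MeasurableSet S ∧ S ⊆ A₀ ∧ μ S = (j + 1) * μ (D.A m) ∧
      ∀ s ∈ S, ∃ x ∈ D.A m \ N, ∃ n γ, f x * (g n)⁻¹ ∈ W 0 ∧ γ * (g n)⁻¹ ∈ W j ∧
        (T : Equiv.Perm X) s = γ • x := by
    intro j
    induction j with
    | zero =>
      intro _
      refine ⟨D.A m \ N, (hmA m).diff hNm, sdiff_subset.trans (hAA₀ m),
        by simp [measure_sdiff_null hN0], fun s hs => ?_⟩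
      obtain ⟨n, hn⟩ := hg (f s)
      exact ⟨s, hs, n, f s, hn, hn,
        (hA₀ s (hAA₀ m hs.1)).symm⟩
    | succ j ih =>
      intro hjm
      obtain ⟨S, hSm, hSA, hSμ, hS⟩ := ih (Nat.le_of_succ_le hjm)
      set R := (T : Equiv.Perm X) '' S \ N with hR
      have hTS : (T : Equiv.Perm X) '' S = (T : Equiv.Perm X).symm ⁻¹' S :=
        Equiv.image_eq_preimage_symm _ _
      have hRm : MeasurableSet R := by
        rw [hR, hTS]
        exact ((mp_symm T).measurable hSm).diff hNm
      have hRμ : μ R = μ S := by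
        rw [hR, measure_sdiff_null hN0, hTS,
          (mp_symm T).measure_preimage hSm.nullMeasurableSet]
      -- Otherwise `γ` would be a round `j` move between two points left over after round `j`: here
      -- `x ∈ D.A m ⊆ D.A (j + 1)`, as `j + 1 ≤ m`.
      have hRB : ∀ t ∈ R, t ∉ D.B (j + 1) := by
        rintro _ ⟨⟨s, hs, rfl⟩, htN⟩
        obtain ⟨x, hx, n, γ, h1, h2, h3⟩ := hS s hs
        rw [h3] at htN ⊢
        exact hN j n γ x h2 h1 (D.antitone_A hjm hx.1) hx.2 htN
      -- Pull `R` back along the matching. Only rounds up to `j` contribute, so `E` misses `D.A m`,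
      -- and it has the measure of `S`.
      let E : ℕ × ℕ → Set X := fun i =>
        D.piece i.1 i.2 ∩ (fun x => (D.move i.1 i.2).2 • x) ⁻¹' R
      have hEm : ∀ i, MeasurableSet (E i) := fun i =>
        (D.measurableSet_piece _ _).inter (measurable_const_smul _ hRm)
      have hEj : ∀ i, ∀ z ∈ E i, i.1 ≤ j := by
        intro i z hz
        by_contra! hlt
        exact hRB _ hz.2 (D.antitone_B hlt (D.smul_piece_subset _ _ (smul_mem_smul_set hz.1)))
      have hER : ⋃ i, (D.move i.1 i.2).2 • E i = R := by
        ext t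
        simp only [mem_iUnion]
        constructor
        · rintro ⟨i, z, hz, rfl⟩
          exact hz.2
        · intro ht
          obtain ⟨j', -, k, z, hz, rfl⟩ := D.exists_mem_smul_piece (mem_univ t) (hRB t ht)
          exact ⟨(j', k), smul_mem_smul_set ⟨hz, ht⟩⟩
      have hEμ : μ (⋃ i, E i) = μ S := by
        rw [← hRμ, ← hER, measure_iUnion
            (fun i i' hi => (D.pairwise_disjoint_piece hi).mono inter_subset_left inter_subset_left) hEm,
          measure_iUnion (fun i i' hi => (D.pairwise_disjoint_smul_piece hi).mono
            (smul_set_mono inter_subset_left) (smul_set_mono inter_subset_left))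
            fun i => (hEm i).const_smul _]
        simp only [measure_smul]
      have hdisj : Disjoint (D.A m \ N) (⋃ i, E i) := by
        rw [disjoint_left]
        intro x hx hxE
        obtain ⟨i, hi⟩ := mem_iUnion.mp hxE
        exact D.notMem_A_of_mem_piece hi.1 ((Nat.lt_succ_of_le (hEj i x hi)).trans_le hjm) hx.1
      have hEA : ⋃ i, E i ⊆ A₀ := iUnion_subset fun i => inter_subset_left.trans
        ((D.piece_subset _ _).trans (hAA₀ i.1))
      refine ⟨D.A m \ N ∪ ⋃ i, E i, ((hmA m).diff hNm).union (MeasurableSet.iUnion hEm),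
        union_subset (sdiff_subset.trans (hAA₀ m)) hEA, ?_, ?_⟩
      · rw [measure_union hdisj (MeasurableSet.iUnion hEm), measure_sdiff_null hN0, hEμ, hSμ]
        push_cast
        ring
      · rintro z (hz | hz)
        · obtain ⟨n, hn⟩ := hg (f z)
          exact ⟨z, hz, n, f z, hn, hW.mono (Nat.zero_le _) hn,
            (hA₀ z (hAA₀ m hz.1)).symm⟩
        · obtain ⟨i, hi⟩ := mem_iUnion.mp hz
          obtain ⟨n', h1, h2⟩ := D.move_mem i.1 i.2
          have hza : f z * (g n')⁻¹ ∈ W 0 := by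
            have := D.piece_subset_move _ _ hi.1
            rwa [h1] at this
          obtain ⟨⟨s, hs, hst⟩, -⟩ := hi.2
          obtain ⟨x, hx, n, γ, h3, h4, h5⟩ := hS s hs
          set δ := (D.move i.1 i.2).2 with hδ
          have hδx : δ • z = γ • x := by rw [← h5, hst]
          refine ⟨x, hx, n, f z * δ⁻¹ * γ, h3, ?_, ?_⟩
          -- The new displacement splits as `(f z * (g n')⁻¹) * (δ * (g n')⁻¹)⁻¹ * (γ * (g n)⁻¹)`;
          -- `n'` cancels, so the reference stays `g n`.
          · have := hW.mul_inv_mul_mem j _ hza _ (hW.mono (hEj i z hi) h2) _ h4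
            convert this using 1
            group
          · rw [← hA₀ z (hEA hz), mul_smul, ← hδx, mul_smul, inv_smul_smul]
  obtain ⟨S, -, -, hS, -⟩ := key m le_rfl
  rw [← hS]
  exact measure_mono (subset_univ _)

/-- For a suitable action, every element of the lifted full group is approximated, up to a left
translation by a small group element and off a set of small measure, by one with countable
essential image. -/
theorem exists_countableRange_near [IsProbabilityMeasure μ] [StandardBorelSpace X]
    (hsuit : IsSuitable G μ) (f : Lifted G μ) {U : Set G} (hU : U ∈ 𝓝 1) (m : ℕ) :
    ∃ h ∈ Lifted.countableRange G μ, ∃ E : Set X, MeasurableSet E ∧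
      μ E ≤ (m + 1 : ENNReal)⁻¹ ∧ ∀ᵐ x ∂μ, x ∉ E → h.1 x * (f.1 x)⁻¹ ∈ U := by
  obtain ⟨W, hW, hWU⟩ := exists_isScale hU m
  let g := TopologicalSpace.denseSeq G
  have hg : ∀ h, ∃ n, h * (g n)⁻¹ ∈ W 0 := by
    intro h
    have hopen : IsOpen ((fun x : G => h * x⁻¹) ⁻¹' W 0) :=
      (hW.isOpen 0).preimage (continuous_const.mul continuous_inv)
    obtain ⟨n, hn⟩ := (TopologicalSpace.denseRange_denseSeq G).exists_mem_open hopen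
      ⟨h, by simpa using hW.one_mem⟩
    exact ⟨n, hn⟩
  have hf : Measurable (f.1 : X → G) := f.1.measurable
  set A₀ : Set X := {x | f.1 x • x = (f.bij : Equiv.Perm X) x} with hA₀
  have hA₀m : MeasurableSet A₀ :=
    measurableSet_eq_fun (hf.smul measurable_id) (mp f.bij).measurable
  have hA₀ae : ∀ᵐ x ∂μ, x ∈ A₀ := f.bij_spec
  obtain ⟨D⟩ := nonempty_greedyMatching (μ := μ) (Q := nearMoves (f.1 : X → G) g W)
    (fun j => ⟨({x | f.1 x * (g 0)⁻¹ ∈ W 0}, g 0), 0, rfl, by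
      simpa using hW.mono (Nat.zero_le j) hW.one_mem⟩)
    (by
      rintro j q ⟨n, hq, -⟩
      rw [hq]
      exact (hf.mul_const _) (hW.isOpen 0).measurableSet)
    hA₀m MeasurableSet.univ
  have hle : ∀ k : ℕ, μ (D.A k) ≤ (k + 1 : ENNReal)⁻¹ := by
    intro k
    have := D.mul_measure_A_le hsuit hf hW hg f.bij (fun x hx => hx) k
    rw [measure_univ, mul_comm] at this
    exact ENNReal.le_inv_iff_mul_le.mpr this
  have hcov : ∀ᵐ x ∂μ, x ∈ ⋃ i : ℕ × ℕ, D.piece i.1 i.2 := by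
    have h0 : μ (⋂ k, D.A k) = 0 := by
      refine le_antisymm (ge_of_tendsto' (x := atTop) (f := fun n : ℕ => (n + 1 : ENNReal)⁻¹) ?_
        fun n => (measure_mono (iInter_subset _ n)).trans (hle n)) bot_le
      have := ENNReal.tendsto_inv_nat_nhds_zero.comp (tendsto_add_atTop_nat 1)
      simpa [Function.comp_def] using this
    filter_upwards [hA₀ae, measure_eq_zero_iff_ae_notMem.mp h0] with x hx hxA
    simp only [mem_iInter, not_forall] at hxA
    obtain ⟨l, hl⟩ := hxA
    obtain ⟨j, -, k, hk⟩ := D.exists_mem_piece hx hl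
    exact mem_iUnion.mpr ⟨(j, k), hk⟩
  have hm1 : ∀ i : ℕ × ℕ, MeasurableSet (D.piece i.1 i.2) := fun i => D.measurableSet_piece _ _
  have hm2 : ∀ i : ℕ × ℕ, MeasurableSet ((D.move i.1 i.2).2 • D.piece i.1 i.2) := fun i =>
    (hm1 i).const_smul _
  -- The disjoint images have the same total measure as the pieces, namely `1`.
  have hcov' : μ (⋃ i : ℕ × ℕ, (D.move i.1 i.2).2 • D.piece i.1 i.2)ᶜ = 0 := by
    rw [prob_compl_eq_zero_iff (MeasurableSet.iUnion hm2),
      measure_iUnion D.pairwise_disjoint_smul_piece hm2]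
    simp only [measure_smul]
    rw [← measure_iUnion D.pairwise_disjoint_piece hm1]
    exact (prob_compl_eq_zero_iff (MeasurableSet.iUnion hm1)).mp hcov
  obtain ⟨h, hh, hhD⟩ := exists_mem_countableRange_of_pieces (μ := μ)
    (fun i : ℕ × ℕ => D.piece i.1 i.2) (fun i => (D.move i.1 i.2).2) hm1
    D.pairwise_disjoint_piece D.pairwise_disjoint_smul_piece hcov hcov'
  refine ⟨h, hh, D.A m, D.measurableSet_A m, hle m, ?_⟩
  filter_upwards [hA₀ae, hhD] with x hx hxD hxA
  obtain ⟨j, hj, k, hk⟩ := D.exists_mem_piece hx hxA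
  obtain ⟨n, h1, h2⟩ := D.move_mem j k
  have h3 : f.1 x * (g n)⁻¹ ∈ W 0 := by
    have := D.piece_subset_move _ _ hk
    rwa [h1] at this
  rw [hxD (j, k) hk]
  have := hWU _ (hW.mono hj.le h2) _ h3
  convert this using 1
  group

end Approximation

/-! ### From closeness up to left translation to the metric of convergence in measure -/

section Density

open Set Filter Topology

theorem CompatibleMetric.continuous_dist {G : Type*} [TopologicalSpace G] (d : CompatibleMetric G) :
    Continuous fun p : G × G => d.metric.dist p.1 p.2 := by
  obtain ⟨dm, hd, -⟩ := d
  subst hd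
  exact _root_.continuous_dist

variable {G X : Type*} [Group G] [TopologicalSpace G] [IsTopologicalGroup G] [PolishSpace G]
  [MeasurableSpace G] [BorelSpace G] [MeasurableSpace X]
  {μ : Measure X}

/-- Left translation by elements of a small enough neighbourhood of the identity displaces the
values of a measurable function uniformly little, off a set of small measure. -/
theorem CompatibleMetric.exists_nhds_one_dist_mul_le [IsFiniteMeasure μ] (d : CompatibleMetric G)
    {f : X → G} (hf : Measurable f) {ε : ℝ} (hε : 0 < ε) {δ : ENNReal} (hδ : δ ≠ 0) :
    ∃ U ∈ 𝓝 (1 : G), ∃ E : Set X, MeasurableSet E ∧ μ E ≤ δ ∧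
      ∀ x ∉ E, ∀ u ∈ U, d.metric.dist (f x) (u * f x) ≤ ε := by
  obtain ⟨U, hU⟩ := (𝓝 (1 : G)).exists_antitone_basis
  -- The metric need not be invariant, so left translation by `U k` may displace points unevenly.
  -- The closed sets `F k` of points displaced by at most `ε` increase to `G`, so `f` takes values
  -- outside `F k` only on a set of small measure.
  let F : ℕ → Set G := fun k => ⋂ u ∈ U k, {h | d.metric.dist h (u * h) ≤ ε}
  have hFc : ∀ k, IsClosed (F k) := fun k => isClosed_biInter fun u _ =>
    isClosed_le (d.continuous_dist.comp (continuous_id.prodMk (continuous_const_mul u)))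
      continuous_const
  have hFmono : Monotone F := fun k l hkl => biInter_subset_biInter_left (hU.antitone hkl)
  have hFcov : ∀ h, ∃ k, h ∈ F k := by
    intro h
    have hcont : Continuous fun u : G => d.metric.dist h (u * h) :=
      d.continuous_dist.comp (continuous_const.prodMk (continuous_mul_const h))
    have hnhds : {u : G | d.metric.dist h (u * h) < ε} ∈ 𝓝 (1 : G) := by
      refine (isOpen_lt hcont continuous_const).mem_nhds ?_
      show d.metric.dist h (1 * h) < ε
      rw [one_mul, d.metric.dist_self]
      exact hε
    obtain ⟨k, -, hk⟩ := hU.toHasBasis.mem_iff.mp hnhds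
    refine ⟨k, mem_iInter₂.mpr fun u hu => ?_⟩
    show d.metric.dist h (u * h) ≤ ε
    exact le_of_lt (hk hu)
  have hm : ∀ k, MeasurableSet (f ⁻¹' (F k)ᶜ) := fun k => hf (hFc k).measurableSet.compl
  have hlim : Tendsto (μ ∘ fun k => f ⁻¹' (F k)ᶜ) atTop (𝓝 (μ (⋂ k, f ⁻¹' (F k)ᶜ))) :=
    tendsto_measure_iInter_atTop (fun k => (hm k).nullMeasurableSet)
      (fun k l hkl => preimage_mono (compl_subset_compl.mpr (hFmono hkl)))
      ⟨0, measure_ne_top _ _⟩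
  have hempty : ⋂ k, f ⁻¹' (F k)ᶜ = ∅ := by
    rw [eq_empty_iff_forall_notMem]
    intro x hx
    obtain ⟨k, hk⟩ := hFcov (f x)
    exact mem_iInter.mp hx k hk
  rw [hempty, measure_empty] at hlim
  obtain ⟨k, hk⟩ := (hlim.eventually (gt_mem_nhds (pos_iff_ne_zero.mpr hδ))).exists
  refine ⟨U k, hU.mem k, f ⁻¹' (F k)ᶜ, hm k, hk.le, fun x hx u hu => ?_⟩
  have hxF : f x ∈ F k := not_not.mp hx
  exact mem_iInter₂.mp hxF u hu

variable [MulAction G X] [MeasurableSMul₂ G X] [SMulInvariantMeasure G X μ] [IsProbabilityMeasure μ]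
  [StandardBorelSpace X]

/-- For a suitable action, the elements with countable essential image come arbitrarily close in
measure to every element of the lifted full group. -/
theorem exists_countableRange_distL0_lt (hsuit : IsSuitable G μ) (d : CompatibleMetric G)
    (f : Lifted G μ) {ε : ℝ} (hε : 0 < ε) :
    ∃ h ∈ Lifted.countableRange G μ, d.distL0 μ f.1 h.1 < ε := by
  obtain ⟨C, hC⟩ := d.bounded
  -- Off two exceptional sets of measure at most `ε / (4 * c)` the distance is at most `ε / 4`, and
  -- on them at most `c`, for a total of `3 * ε / 4`. The maximum with `1` keeps `c` positive.
  set c := max C 1 with hc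
  have hc0 : 0 < c := lt_max_of_lt_right one_pos
  have hδ : ENNReal.ofReal (ε / (4 * c)) ≠ 0 := by
    rw [Ne, ENNReal.ofReal_eq_zero, not_le]
    positivity
  obtain ⟨U, hU, E, hE, hEμ, hEU⟩ := d.exists_nhds_one_dist_mul_le (μ := μ) f.1.measurable
    (show 0 < ε / 4 by positivity) hδ
  obtain ⟨m, hm⟩ := ENNReal.exists_inv_nat_lt hδ
  obtain ⟨h, hh, E', hE', hE'μ, hhU⟩ := exists_countableRange_near hsuit f hU m
  refine ⟨h, hh, ?_⟩
  have hμE' : μ E' ≤ ENNReal.ofReal (ε / (4 * c)) := by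
    refine hE'μ.trans (le_trans ?_ hm.le)
    exact ENNReal.inv_le_inv.mpr le_self_add
  have hreal : ∀ S : Set X, μ S ≤ ENNReal.ofReal (ε / (4 * c)) → μ.real S ≤ ε / (4 * c) :=
    fun S hS => ENNReal.toReal_le_of_le_ofReal (by positivity) hS
  have hle : ∀ᵐ x ∂μ, d.metric.dist (f.1 x) (h.1 x) ≤
      ε / 4 + (E ∪ E').indicator (fun _ => c) x := by
    filter_upwards [hhU] with x hx
    by_cases hxE : x ∈ E ∪ E'
    · rw [indicator_of_mem hxE]
      have := (hC (f.1 x) (h.1 x)).trans (le_max_left C 1)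
      linarith
    · rw [indicator_of_notMem hxE, add_zero]
      have := hEU x (fun hx => hxE (Or.inl hx)) _ (hx fun hx => hxE (Or.inr hx))
      rwa [inv_mul_cancel_right] at this
  have hint : Integrable ((E ∪ E').indicator fun _ => c) μ :=
    (integrable_const c).indicator (hE.union hE')
  calc d.distL0 μ f.1 h.1 ≤ ∫ x, (ε / 4 + (E ∪ E').indicator (fun _ => c) x) ∂μ :=
        integral_mono_of_nonneg (.of_forall fun x => @dist_nonneg G d.metric.toPseudoMetricSpace _ _)
          ((integrable_const _).add hint) hle
    _ = ε / 4 + μ.real (E ∪ E') * c := by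
        rw [integral_add (integrable_const _) hint, integral_indicator_const c (hE.union hE')]
        simp
    _ ≤ ε / 4 + (ε / (4 * c) + ε / (4 * c)) * c := by
        gcongr
        exact (measureReal_union_le E E').trans (add_le_add (hreal E hEμ) (hreal E' hμE'))
    _ = ε * (3 / 4) := by field_simp; ring
    _ < ε := by linarith

theorem dense_countableRange (hsuit : IsSuitable G μ) (d : CompatibleMetric G) :
    @Dense (Lifted G μ) (d.liftedTopology μ) (Lifted.countableRange G μ : Set (Lifted G μ)) := by
  let _ := d.liftedTopology μ
  refine dense_iff_inter_open.mpr fun U hU hne => ?_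
  obtain ⟨f, hf⟩ := hne
  obtain ⟨ε, hε, hball⟩ := hU f hf
  obtain ⟨h, hh, hlt⟩ := exists_countableRange_distL0_lt hsuit d f hε
  exact ⟨h, hball h hlt, hh⟩

/-- A continuous surjection carries dense sets to dense sets, and `Φ` is continuous for the quotient
topology. -/
theorem dense_map_PhiOrbit_countableRange (hsuit : IsSuitable G μ) (d : CompatibleMetric G) :
    @Dense (orbitFullGroup G μ) (d.orbitTopology μ)
      ((Lifted.countableRange G μ).map (Lifted.PhiOrbit G μ) : Set (orbitFullGroup G μ)) := by
  let _ := d.liftedTopology μ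
  let _ := d.orbitTopology μ
  exact (PhiOrbit_surjective (G := G) (μ := μ)).denseRange.dense_image continuous_coinduced_rng
    (dense_countableRange hsuit d)

end Density

end FullGroup

theorem mainTheorem5 {G X : Type*}
    [Group G] [TopologicalSpace G] [IsTopologicalGroup G] [PolishSpace G]
    [MeasurableSpace G] [BorelSpace G]
    [MeasurableSpace X] [StandardBorelSpace X]
    (μ : Measure X) [IsProbabilityMeasure μ] [NullSingletonClass μ]
    [MulAction G X] [MeasurableSMul₂ G X] [SMulInvariantMeasure G X μ]
    (hsuit : FullGroup.IsSuitable G μ)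
    (d : FullGroup.CompatibleMetric G) :
    -- the subgroup of elements with countable range is dense in the lifted full group
    @Dense (FullGroup.Lifted G μ) (d.liftedTopology μ)
      (FullGroup.Lifted.countableRange G μ : Set (FullGroup.Lifted G μ)) ∧
    -- its image under `Φ` is the smallest full group containing the image of `G`
    IsLeast {K : Subgroup (FullGroup.Aut μ) |
        FullGroup.IsFull K ∧ (FullGroup.actionHom G μ).range ≤ K}
      ((FullGroup.Lifted.countableRange G μ).map (FullGroup.Lifted.Phi G μ)) ∧
    -- and this smallest full group is dense in the orbit full group
    @Dense (FullGroup.orbitFullGroup G μ) (d.orbitTopology μ)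
      ((FullGroup.Lifted.countableRange G μ).map (FullGroup.Lifted.PhiOrbit G μ) :
        Set (FullGroup.orbitFullGroup G μ)) := by
  exact ⟨FullGroup.dense_countableRange hsuit d,
    ⟨⟨FullGroup.isFull_map_Phi_countableRange, FullGroup.range_actionHom_le_map_Phi_countableRange⟩,
      fun _ hK => FullGroup.map_Phi_countableRange_le_of_isFull hK.1 hK.2⟩,
    FullGroup.dense_map_PhiOrbit_countableRange hsuit d⟩
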